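/- Let $n$ be a positive integer. Write $J=\begin{bmatrix}0&-I_n\\ I_n&0\end{bmatrix}$; for $X\in\mathbb{C}^{2n\times 2n}$ let $X^{\mathsf S}:=-JX^{\mathsf T}J$ be its symplectic adjoint, and let $\mathsf{Y}^2(\mathbb{C}^{2n}):=\{X\in\mathbb{C}^{2n\times 2n}:X=X^{\mathsf S}\}$. Let $\mathrm{U}(2n)$ be the group of unitary $2n\times 2n$ matrices and $\mathrm{Sp}(n):=\mathrm{U}(2n)\cap\mathrm{Sp}(2n,\mathbb{C})=\{Q\in\mathrm{U}(2n):Q^{\mathsf T}JQ=J\}$ the compact symplectic group. Let $\mathbb{H}$ be the quaternions, with $\mathbb{C}\subset\mathbb{H}$ as usual, and regard $\mathbb{H}^{2n}$ as a right $\mathbb{H}$-vector space with its standard skew-Hermitian form $\omega(x,y)=\sum_{a=1}^{2n}\bar x_a\,\mathrm{i}\,y_a$. Let $\mathrm{LGr}(\mathbb{H}^{2n})$ be the set of Lagrangian subspaces, i.e. the $\mathbb{H}$-subspaces $W\subseteq\mathbb{H}^{2n}$ that equal their own $\omega$-orthogonal complement. It is regarded as a submanifold of the quaternionic Grassmannian,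 where a subspace is identified with the orthogonal projection onto it, and $\mathrm{U}(2n)$ acts on it by $(A,W)\mapsto AW$. Then $$\mathrm{LGr}(\mathbb{H}^{2n})\;\cong\;\mathrm{U}(2n)/\mathrm{Sp}(n)\;\cong\;\{QQ^{\mathsf S}:Q\in\mathrm{U}(2n)\}\;=\;\mathrm{U}(2n)\cap\mathsf{Y}^2(\mathbb{C}^{2n})\;=\;\{X\in\mathrm{U}(2n):X=X^{\mathsf S}\}.$$ Here each $\cong$ is a $\mathrm{U}(2n)$-equivariant $C^\infty$ diffeomorphism. The homogeneous space $\mathrm{U}(2n)/\mathrm{Sp}(n)$ has its usual quotient manifold structure and the action by left multiplication, while $\{QQ^{\mathsf S}:Q\in\mathrm{U}(2n)\}$ is an embedded submanifold of $\mathbb{C}^{2n\times 2n}$ with the action $(A,X)\mapsto AXA^{\mathsf S}$. -/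

import Mathlib

open Matrix Manifold
open scoped ContDiff Quaternion MulOpposite

noncomputable section

namespace QLGr

/-! ### Complex matrices of size `2n` -/

/-- Complex `2n × 2n` matrices; the index set is written as two blocks of size `n`. -/
abbrev CMat (n : ℕ) : Type := Matrix (Fin n ⊕ Fin n) (Fin n ⊕ Fin n) ℂ

/-- The ambient real normed space `ℂ²ⁿˣ²ⁿ` (arrays of entries) in which sets of matrices are regarded
as submanifolds. All norms on it are equivalent. -/
abbrev Entries (n : ℕ) : Type := Fin n ⊕ Fin n → Fin n ⊕ Fin n → ℂ

/-- The array of entries of a matrix. -/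
def entries {n : ℕ} (X : CMat n) : Entries n := fun i j => X i j

/-- The unitary group `U(2n)`. -/
abbrev U2 (n : ℕ) : Submonoid (CMat n) := Matrix.unitaryGroup (Fin n ⊕ Fin n) ℂ

/-- The symplectic adjoint `-J Xᵀ J`, where `J` is the block matrix `[[0, -1], [1, 0]]`. -/
def sAdj {n : ℕ} (X : CMat n) : CMat n :=
  -(Matrix.J (Fin n) ℂ * Xᵀ * Matrix.J (Fin n) ℂ)

/-- The complex vector space `Y²(ℂ²ⁿ)` of symplectically symmetric matrices. -/
def Y2 (n : ℕ) : Submodule ℂ (CMat n) where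
  carrier := {X | X = sAdj X}
  add_mem' {X Y} hX hY := by
    have hX' : X = sAdj X := hX
    have hY' : Y = sAdj Y := hY
    change X + Y = sAdj (X + Y)
    conv_lhs => rw [hX', hY']
    simp [sAdj, Matrix.mul_add, Matrix.add_mul, add_comm]
  zero_mem' := by
    change (0 : CMat n) = sAdj 0
    simp [sAdj]
  smul_mem' c X hX := by
    have hX' : X = sAdj X := hX
    change c • X = sAdj (c • X)
    conv_lhs => rw [hX']
    simp [sAdj]

/-- The compact symplectic group `Sp(n) = U(2n) ∩ Sp(2n, ℂ)`, as a subgroup of `U(2n)`. -/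
def Sp (n : ℕ) : Subgroup (U2 n) where
  carrier := {Q | (Q : CMat n) ∈ Matrix.symplecticGroup (Fin n) ℂ}
  mul_mem' {P Q} hP hQ := (Matrix.symplecticGroup (Fin n) ℂ).mul_mem hP hQ
  one_mem' := (Matrix.symplecticGroup (Fin n) ℂ).one_mem
  inv_mem' {Q} hQ := by
    have hQ' : (Q : CMat n) ∈ Matrix.symplecticGroup (Fin n) ℂ := hQ
    have h1 : ((Q⁻¹ : U2 n) : CMat n) * (Q : CMat n) = 1 := by
      rw [← Submonoid.coe_mul, inv_mul_cancel, Submonoid.coe_one]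
    have h2 : (Q : CMat n)⁻¹ = ((Q⁻¹ : U2 n) : CMat n) := Matrix.inv_eq_left_inv h1
    have h3 := SymplecticGroup.coe_inv' (⟨(Q : CMat n), hQ'⟩ : Matrix.symplecticGroup (Fin n) ℂ)
    change ((Q⁻¹ : U2 n) : CMat n) ∈ Matrix.symplecticGroup (Fin n) ℂ
    rw [← h2]
    simp only at h3
    rw [← h3]
    exact Subtype.property _

/-- The set of matrices `Q Q^S` with `Q` unitary. -/
def squares (n : ℕ) : Set (CMat n) := {X | ∃ Q ∈ U2 n, X = Q * sAdj Q}

/-! ### Quaternionic Lagrangian subspaces -/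

/-- The right quaternionic vector space `ℍ²ⁿ` (scalars act through `ℍᵐᵒᵖ`), with its standard
Euclidean inner product as a real vector space. -/
abbrev HVec (n : ℕ) : Type := PiLp 2 (fun _ : Fin n ⊕ Fin n => ℍ[ℝ])

/-- The standard skew-Hermitian form `∑ₐ x̄ₐ i yₐ` on `ℍ²ⁿ`. -/
def skewForm {n : ℕ} (x y : HVec n) : ℍ[ℝ] :=
  ∑ a, star (x a) * ((Complex.I : ℂ) : ℍ[ℝ]) * y a

/-- A subspace is Lagrangian if it equals its orthogonal complement for the form. -/
def IsLagrangian {n : ℕ} (W : Submodule ℍ[ℝ]ᵐᵒᵖ (HVec n)) : Prop :=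
  ∀ x, x ∈ W ↔ ∀ y ∈ W, skewForm x y = 0

/-- The set of Lagrangian subspaces of `ℍ²ⁿ`. -/
def LGr (n : ℕ) : Type := {W : Submodule ℍ[ℝ]ᵐᵒᵖ (HVec n) // IsLagrangian W}

/-- The orthogonal projection of `ℍ²ⁿ` onto a Lagrangian subspace. The orthogonal complement of a
quaternionic subspace for the Hermitian form `∑ₐ x̄ₐ yₐ` is its complement for the real inner
product, so this is also the quaternionic orthogonal projection. -/
def proj {n : ℕ} (W : LGr n) : HVec n →L[ℝ] HVec n :=
  (W.1.restrictScalars ℝ).starProjection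

/-- The topology of `LGr` as a subspace of the Grassmannian, i.e. as a space of orthogonal
projections. -/
instance (n : ℕ) : TopologicalSpace (LGr n) := TopologicalSpace.induced proj inferInstance

/-- A complex matrix acting on `ℍ²ⁿ` by multiplication from the left, where `ℂ ⊆ ℍ`. -/
def act {n : ℕ} (A : CMat n) : HVec n →ₗ[ℍ[ℝ]ᵐᵒᵖ] HVec n where
  toFun x := WithLp.toLp 2 (fun a => ∑ b, ((A a b : ℂ) : ℍ[ℝ]) * x b)
  map_add' x y := by
    ext1 a
    simp [mul_add, Finset.sum_add_distrib]
  map_smul' c x := by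
    ext1 a
    simp [Finset.sum_mul, mul_assoc]

theorem act_apply {n : ℕ} (A : CMat n) (x : HVec n) (a : Fin n ⊕ Fin n) :
    act A x a = ∑ b, ((A a b : ℂ) : ℍ[ℝ]) * x b := rfl

theorem act_one {n : ℕ} : act (1 : CMat n) = LinearMap.id := by
  ext1 x
  ext1 a
  simp [act_apply, Matrix.one_apply, apply_ite Quaternion.coeComplex]

theorem coe_sum {ι : Type*} (s : Finset ι) (f : ι → ℂ) :
    ((∑ i ∈ s, f i : ℂ) : ℍ[ℝ]) = ∑ i ∈ s, ((f i : ℂ) : ℍ[ℝ]) :=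
  map_sum Quaternion.ofComplex f s

theorem act_mul {n : ℕ} (A B : CMat n) : act (A * B) = act A ∘ₗ act B := by
  ext1 x
  ext1 a
  simp only [act_apply, Matrix.mul_apply, LinearMap.comp_apply, coe_sum, Finset.sum_mul,
    Finset.mul_sum, Quaternion.coeComplex_mul, mul_assoc]
  rw [Finset.sum_comm]

theorem coe_star (z : ℂ) : ((star z : ℂ) : ℍ[ℝ]) = star (z : ℍ[ℝ]) := by
  ext <;> simp

theorem skewForm_act {n : ℕ} (A : CMat n) (x y : HVec n) :
    skewForm (act A x) y = skewForm x (act (star A) y) := by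
  have hc : ∀ z : ℂ, (z : ℍ[ℝ]) * ((Complex.I : ℂ) : ℍ[ℝ]) = ((Complex.I : ℂ) : ℍ[ℝ]) * z := by
    intro z
    rw [← Quaternion.coeComplex_mul, ← Quaternion.coeComplex_mul, mul_comm]
  simp only [skewForm, act_apply, star_sum, star_mul, Finset.sum_mul, Finset.mul_sum,
    Matrix.star_apply, coe_star]
  rw [Finset.sum_comm]
  refine Finset.sum_congr rfl fun b _ => Finset.sum_congr rfl fun a _ => ?_
  rw [← coe_star, mul_assoc (star (x b)), hc]
  simp only [mul_assoc]

theorem act_star_act {n : ℕ} (A : U2 n) (x : HVec n) : act (star (A : CMat n)) (act A x) = x := by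
  rw [← LinearMap.comp_apply, ← act_mul, Unitary.coe_star_mul_self, act_one, LinearMap.id_apply]

theorem act_act_star {n : ℕ} (A : U2 n) (x : HVec n) : act (A : CMat n) (act (star A.1) x) = x := by
  rw [← LinearMap.comp_apply, ← act_mul, Unitary.mul_star_self_of_mem A.2, act_one,
    LinearMap.id_apply]

theorem IsLagrangian.map {n : ℕ} (A : U2 n) {W : Submodule ℍ[ℝ]ᵐᵒᵖ (HVec n)}
    (hW : IsLagrangian W) : IsLagrangian (W.map (act (A : CMat n))) := by
  intro x
  have h1 : x ∈ W.map (act (A : CMat n)) ↔ act (star A.1) x ∈ W := by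
    constructor
    · rintro ⟨w, hw, rfl⟩
      rwa [act_star_act]
    · intro h
      exact ⟨_, h, act_act_star A x⟩
  rw [h1, hW]
  constructor
  · rintro h _ ⟨w, hw, rfl⟩
    have := h w hw
    rwa [skewForm_act, star_star] at this
  · intro h w hw
    rw [skewForm_act, star_star]
    exact h _ ⟨w, hw, rfl⟩

/-- The natural action of `U(2n)` on Lagrangian subspaces: `A • W` is the image of `W`. -/
instance (n : ℕ) : MulAction (U2 n) (LGr n) where
  smul A W := ⟨W.1.map (act (A : CMat n)), W.2.map A⟩
  one_smul W := Subtype.ext <| by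
    change W.1.map (act (1 : CMat n)) = W.1
    rw [act_one, Submodule.map_id]
  mul_smul A B W := Subtype.ext <| by
    change W.1.map (act ((A : CMat n) * (B : CMat n))) = (W.1.map (act (B : CMat n))).map (act A.1)
    rw [act_mul, Submodule.map_comp]

/-! ### Smooth quotients -/

/-- The manifold structure of a homogeneous space `G ⧸ H` (it is the unique one with these two
properties): the quotient map is smooth and has smooth local sections. -/
def IsSmoothQuotient {k d : ℕ} {G : Type*} [Group G] [TopologicalSpace G]
    [ChartedSpace (EuclideanSpace ℝ (Fin k)) G] (H : Subgroup G)
    [ChartedSpace (EuclideanSpace ℝ (Fin d)) (G ⧸ H)] : Prop :=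
  ContMDiff (𝓡 k) (𝓡 d) ∞ (QuotientGroup.mk : G → G ⧸ H) ∧
    ∀ q : G ⧸ H, ∃ V : Set (G ⧸ H), IsOpen V ∧ q ∈ V ∧ ∃ s : G ⧸ H → G,
      ContMDiffOn (𝓡 d) (𝓡 k) ∞ s V ∧ ∀ p ∈ V, (QuotientGroup.mk (s p) : G ⧸ H) = p

end QLGr

end

/-! ### Submanifolds of a normed space given by slice charts -/

section Slices

open Topology Set

noncomputable section

variable {E : Type*} [NormedAddCommGroup E] [NormedSpace ℝ E]

/-! All four spaces are models of one submanifold, the set of unitary X with X = X^S.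

Algebra. Let P be the orthogonal projection onto a Lagrangian W and R = 2P - 1. The Lagrangian
condition says that left multiplication by i exchanges W and its orthogonal complement, so R is a
right-linear symmetric involution anticommuting with i. A right-linear map has the form A + Bj with
complex matrices A, B. Anticommuting with i forces A = 0, symmetry means Bᵀ = -B, and R² = 1 means
BB* = 1. With X = BJ these two conditions become: X is unitary and X = X^S. Thus P = (1 + Bj)/2
depends affinely and injectively on X (`exists_isSkewUnitary`, `exists_lagrangian_of_isSkewUnitary`,
`range_proj`). A unitary X has a unitary square root Q that is a polynomial in X. If X = X^S then Q
= Q^S, hence X = QQ^S (`squares_eq`). Under X ↦ AXA^S the stabilizer of 1 is Sp(n), so [Q] ↦ QQ^S is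
injective on the quotient, and by compactness it is a topological embedding.

Smoothness. After a translation to 1, the Cayley transform turns unitarity into skew-Hermitian
symmetry and preserves X = X^S. It therefore gives ambient charts in which U(2n) and {QQ^S} are
linear (`isSliced_unitary`, `isSliced_squares`). An injective affine map carries such charts to the
projections. The quotient receives its charts through [Q] ↦ QQ^S; that these are the standard ones
rests on smooth local sections, obtained from a local square root (`exists_local_sqrt`). Every
remaining map is smooth because smoothness can be tested after a smooth embedding. -/

/-- A set `S` is cut out by the linear subspace `F` in smooth ambient charts around each of its
points. -/
def IsSliced (S : Set E) (F : Submodule ℝ E) : Prop :=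
  ∀ x ∈ S, ∃ φ : OpenPartialHomeomorph E E, x ∈ φ.source ∧
    ContDiffOn ℝ ∞ φ φ.source ∧ ContDiffOn ℝ ∞ φ.symm φ.target ∧ ∀ y ∈ φ.source, y ∈ S ↔ φ y ∈ F

/-- An injective affine map of finite-dimensional spaces preserves sliced sets. -/
theorem IsSliced.image {E' : Type*} [NormedAddCommGroup E'] [NormedSpace ℝ E']
    [FiniteDimensional ℝ E] [FiniteDimensional ℝ E'] {S : Set E} {F : Submodule ℝ E}
    (h : IsSliced S F) (i : E →ₗ[ℝ] E') (hi : Function.Injective i) (c : E') :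
    IsSliced ((fun y => c + i y) '' S) (F.map i) := by
  obtain ⟨C, hC⟩ := Submodule.exists_isCompl (LinearMap.range i)
  let T : (E × C) ≃L[ℝ] E' := ((LinearEquiv.prodCongr (LinearEquiv.ofInjective i hi)
    (LinearEquiv.refl ℝ C)).trans (Submodule.prodEquivOfIsCompl _ C hC)).toContinuousLinearEquiv
  have hT : ∀ y : E, T (y, 0) = i y := fun y => by simp [T]
  have hTs : ∀ y : E, T.symm (i y) = (y, 0) := fun y => by rw [← hT, T.symm_apply_apply]
  rintro _ ⟨x, hx, rfl⟩
  obtain ⟨φ, hxφ, h1, h2, h3⟩ := h x hx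
  -- Split E' as the range of `i` plus a complement, after removing the shift `c`; `φ` acts on the
  -- first factor and the identity on the second.
  let ψ : OpenPartialHomeomorph E' E' :=
    (((Homeomorph.subRight c).trans T.symm.toHomeomorph).toOpenPartialHomeomorph.trans
      (φ.prod (OpenPartialHomeomorph.refl C))).trans T.toHomeomorph.toOpenPartialHomeomorph
  have hψ : ∀ y, ψ y = T (φ (T.symm (y - c)).1, (T.symm (y - c)).2) := fun y => rfl
  have hsrc : ∀ y, y ∈ ψ.source ↔ (T.symm (y - c)).1 ∈ φ.source := fun y => by
    simp [ψ]
  have htgt : ∀ y, y ∈ ψ.target ↔ (T.symm y).1 ∈ φ.target := fun y => by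
    simp [ψ]
  refine ⟨ψ, ?_, ?_, ?_, ?_⟩
  · rw [hsrc]
    simpa [hTs] using hxφ
  · have : ContDiffOn ℝ ∞ (fun y => T (φ (T.symm (y - c)).1, (T.symm (y - c)).2)) ψ.source := by
      refine T.contDiff.comp_contDiffOn (ContDiffOn.prodMk (h1.comp ?_ fun y hy => (hsrc y).1 hy) ?_)
      · exact (T.symm.contDiff.comp (contDiff_id.sub contDiff_const)).fst.contDiffOn
      · exact (T.symm.contDiff.comp (contDiff_id.sub contDiff_const)).snd.contDiffOn
    exact this
  · have : ContDiffOn ℝ ∞ (fun y => T (φ.symm (T.symm y).1, (T.symm y).2) + c) ψ.target := by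
      refine (T.contDiff.comp_contDiffOn
        (ContDiffOn.prodMk (h2.comp ?_ fun y hy => (htgt y).1 hy) ?_)).add contDiffOn_const
      · exact T.symm.contDiff.fst.contDiffOn
      · exact T.symm.contDiff.snd.contDiffOn
    exact this
  · intro y hy
    rw [hsrc] at hy
    rw [hψ]
    obtain ⟨u, v, huv⟩ : ∃ u v, T (u, v) = y - c :=
      ⟨_, _, T.apply_symm_apply (y - c)⟩
    have hy' : y = c + T (u, v) := by rw [huv]; abel
    rw [← huv, T.symm_apply_apply] at hy ⊢
    constructor
    · rintro ⟨z, hz, hzy⟩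
      have : T (u, v) = T (z, 0) := by
        rw [hT]
        exact add_left_cancel (hy'.symm.trans hzy.symm)
      have huz : u = z ∧ v = 0 := Prod.ext_iff.1 (T.injective this)
      refine ⟨φ u, (h3 u hy).1 (huz.1 ▸ hz), ?_⟩
      rw [← hT, huz.2]
    · rintro ⟨z, hz, hzy⟩
      rw [← hT] at hzy
      obtain ⟨hz1, hz2⟩ := Prod.ext_iff.1 (T.injective hzy)
      simp only at hz1 hz2
      refine ⟨u, (h3 u hy).2 (hz1 ▸ hz), ?_⟩
      rw [hy', ← hz2, hT]

/-- A complemented subspace in coordinates. -/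
theorem Submodule.exists_prod_equiv [FiniteDimensional ℝ E] (F : Submodule ℝ E) {d : ℕ}
    (hd : Module.finrank ℝ F = d) : ∃ (C : Submodule ℝ E) (e : (EuclideanSpace ℝ (Fin d) × C) ≃L[ℝ] E),
      ∀ y, y ∈ F ↔ (e.symm y).2 = 0 := by
  obtain ⟨C, hC⟩ := Submodule.exists_isCompl F
  let k : EuclideanSpace ℝ (Fin d) ≃ₗ[ℝ] F := LinearEquiv.ofFinrankEq _ _ (by simp [hd])
  refine ⟨C, ((k.prodCongr (LinearEquiv.refl ℝ C)).trans
    (Submodule.prodEquivOfIsCompl F C hC)).toContinuousLinearEquiv, fun y => ?_⟩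
  exact (Submodule.prodEquivOfIsCompl_symm_apply_snd_eq_zero F C hC).symm

variable {M : Type*} [TopologicalSpace M] {V : Type*} [NormedAddCommGroup V] [NormedSpace ℝ V]
  {C : Type*} [NormedAddCommGroup C] [NormedSpace ℝ C]

/-- The chart of `M` induced by an ambient slice chart. -/
def sliceChart [Nonempty M] {f : M → E} (hf : IsEmbedding f) (e : (V × C) ≃L[ℝ] E)
    (φ : OpenPartialHomeomorph E E)
    (h : ∀ y ∈ φ.source, y ∈ range f ↔ (e.symm (φ y)).2 = 0) : OpenPartialHomeomorph M V where
  toFun m := (e.symm (φ (f m))).1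
  -- `Function.invFun` is meaningful only on the range of `f`; the slice condition puts `φ.symm (e
  -- (u, 0))` there whenever `u` is in the target.
  invFun u := Function.invFun f (φ.symm (e (u, 0)))
  source := f ⁻¹' φ.source
  target := {u | e (u, 0) ∈ φ.target}
  map_source' m hm := by
    have h2 := (h _ hm).1 ⟨m, rfl⟩
    have h3 : e ((e.symm (φ (f m))).1, 0) = φ (f m) := by
      rw [← h2, Prod.mk.eta, e.apply_symm_apply]
    change _ ∈ φ.target
    rw [h3]
    exact φ.map_source hm
  map_target' u hu := by
    have h1 : φ.symm (e (u, 0)) ∈ range f :=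
      (h _ (φ.map_target hu)).2 (by rw [φ.right_inv hu, e.symm_apply_apply])
    change f _ ∈ φ.source
    rw [Function.invFun_eq h1]
    exact φ.map_target hu
  left_inv' m hm := by
    have h2 := (h _ hm).1 ⟨m, rfl⟩
    have h3 : e ((e.symm (φ (f m))).1, 0) = φ (f m) := by
      rw [← h2, Prod.mk.eta, e.apply_symm_apply]
    rw [h3, φ.left_inv hm]
    exact Function.leftInverse_invFun hf.injective m
  right_inv' u hu := by
    have h1 : φ.symm (e (u, 0)) ∈ range f :=
      (h _ (φ.map_target hu)).2 (by rw [φ.right_inv hu, e.symm_apply_apply])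
    rw [Function.invFun_eq h1, φ.right_inv hu, e.symm_apply_apply]
  open_source := φ.open_source.preimage hf.continuous
  open_target := φ.open_target.preimage (by fun_prop)
  continuousOn_toFun := by
    refine (continuous_fst.comp e.symm.continuous).comp_continuousOn
      (φ.continuousOn.comp hf.continuous.continuousOn fun _ h => h)
  continuousOn_invFun := by
    rw [hf.continuousOn_iff]
    have : ContinuousOn (fun u => φ.symm (e (u, 0))) {u | e (u, 0) ∈ φ.target} :=
      φ.symm.continuousOn.comp (by fun_prop) fun _ h => h
    refine this.congr fun u hu => ?_
    exact Function.invFun_eq ((h _ (φ.map_target hu)).2 (by rw [φ.right_inv hu, e.symm_apply_apply]))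

theorem apply_sliceChart_symm [Nonempty M] {f : M → E} (hf : IsEmbedding f) (e : (V × C) ≃L[ℝ] E)
    (φ : OpenPartialHomeomorph E E)
    (h : ∀ y ∈ φ.source, y ∈ range f ↔ (e.symm (φ y)).2 = 0) {u : V} (hu : e (u, 0) ∈ φ.target) :
    f ((sliceChart hf e φ h).symm u) = φ.symm (e (u, 0)) :=
  Function.invFun_eq ((h _ (φ.map_target hu)).2 (by rw [φ.right_inv hu, e.symm_apply_apply]))

/-- The preimage of a sliced set under an embedding is an embedded submanifold. -/
theorem IsSliced.exists_chartedSpace [FiniteDimensional ℝ E] {S : Set E} {F : Submodule ℝ E}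
    (hS : IsSliced S F) {d : ℕ} (hd : Module.finrank ℝ F = d) {f : M → E} (hf : IsEmbedding f)
    (hr : range f = S) :
    ∃ _ : ChartedSpace (EuclideanSpace ℝ (Fin d)) M,
      IsManifold (𝓡 d) ∞ M ∧ IsSmoothEmbedding (𝓡 d) 𝓘(ℝ, E) ∞ f := by
  obtain ⟨C, e, he⟩ := F.exists_prod_equiv hd
  subst hr
  have hS' : ∀ m : M, ∃ φ : OpenPartialHomeomorph E E, f m ∈ φ.source ∧
    ContDiffOn ℝ ∞ φ φ.source ∧ ContDiffOn ℝ ∞ φ.symm φ.target ∧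
      ∀ y ∈ φ.source, y ∈ range f ↔ (e.symm (φ y)).2 = 0 := fun m => by
    simpa only [he] using hS (f m) ⟨m, rfl⟩
  choose φ h1 h2 h3 h4 using hS'
  let cs : ChartedSpace (EuclideanSpace ℝ (Fin d)) M :=
    { atlas := range fun m => (haveI : Nonempty M := ⟨m⟩; sliceChart hf e (φ m) (h4 m))
      chartAt := fun m => (haveI : Nonempty M := ⟨m⟩; sliceChart hf e (φ m) (h4 m))
      mem_chart_source := h1
      chart_mem_atlas := fun m => ⟨m, rfl⟩ }
  have hman : IsManifold (𝓡 d) ∞ M := by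
    refine isManifold_of_contDiffOn _ _ _ ?_
    rintro _ _ ⟨m, rfl⟩ ⟨m', rfl⟩
    have : Nonempty M := ⟨m⟩
    simp only [modelWithCornersSelf_coe, modelWithCornersSelf_coe_symm, Function.id_comp,
      Function.comp_id, range_id, inter_univ, preimage_id_eq, id]
    have : ContDiffOn ℝ ∞ (fun u => (e.symm (φ m' ((φ m).symm (e (u, 0))))).1)
        ((sliceChart hf e (φ m) (h4 m)).symm.trans (sliceChart hf e (φ m') (h4 m'))).source := by
      refine contDiff_fst.comp_contDiffOn (e.symm.contDiff.comp_contDiffOn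
        ((h2 m').comp ((h3 m).comp ?_ ?_) ?_))
      · exact (e.contDiff.comp (contDiff_id.prodMk contDiff_const)).contDiffOn
      · rintro u ⟨hu, -⟩
        exact hu
      · rintro u ⟨hu, hu'⟩
        have hu'' : f ((sliceChart hf e (φ m) (h4 m)).symm u) ∈ (φ m').source := hu'
        rw [apply_sliceChart_symm hf e (φ m) (h4 m) hu] at hu''
        exact hu''
    refine this.congr ?_
    rintro u ⟨hu, hu'⟩
    change (e.symm (φ m' (f ((sliceChart hf e (φ m) (h4 m)).symm u)))).1 = _
    rw [apply_sliceChart_symm hf e (φ m) (h4 m) hu]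
  refine ⟨cs, hman, ?_, hf⟩
  -- Read in the chart of `M` and the ambient chart that induced it, `f` is exactly u ↦ e (u, 0),
  -- the normal form of an immersion.
  refine IsImmersionOfComplement.isImmersion (F := C) fun m => ?_
  have : Nonempty M := ⟨m⟩
  refine IsImmersionAtOfComplement.mk_of_continuousAt hf.continuous.continuousAt e
    (sliceChart hf e (φ m) (h4 m)) (φ m) (h1 m) (h1 m)
    (IsManifold.subset_maximalAtlas ⟨m, rfl⟩) ?_ ?_
  · rw [IsManifold.mem_maximalAtlas_iff_contMDiffOn]
    exact ⟨contMDiffOn_iff_contDiffOn.2 (h2 m), contMDiffOn_iff_contDiffOn.2 (h3 m)⟩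
  · intro u hu
    have hu' : e (u, 0) ∈ (φ m).target := by
      rw [OpenPartialHomeomorph.extend_target] at hu
      exact hu.1
    change φ m (f ((sliceChart hf e (φ m) (h4 m)).symm u)) = e (u, 0)
    rw [apply_sliceChart_symm hf e (φ m) (h4 m) hu', (φ m).right_inv hu']

end

end Slices

/-! ### The Cayley transform -/

section Cayley

noncomputable section

/-- The Cayley transform `(1 - a) (1 + a)⁻¹`. -/
def cayley {A : Type*} [Ring A] (a : A) : A := (1 - a) * Ring.inverse (1 + a)

section Algebra

variable {A : Type*} [Ring A]

theorem one_sub_mul_inverse_one_add {a : A} (h : IsUnit (1 + a)) :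
    (1 - a) * Ring.inverse (1 + a) = Ring.inverse (1 + a) * (1 - a) := by
  have h1 : Commute (1 - a) (1 + a) :=
    (Commute.one_left _).sub_left ((Commute.one_right a).add_right (Commute.refl a))
  obtain ⟨u, hu⟩ := h
  rw [← hu] at h1 ⊢
  rw [Ring.inverse_unit]
  exact h1.units_inv_right.eq

theorem one_add_cayley {a : A} (h : IsUnit (1 + a)) :
    1 + cayley a = 2 * Ring.inverse (1 + a) := by
  calc 1 + cayley a = (1 + a) * Ring.inverse (1 + a) + (1 - a) * Ring.inverse (1 + a) := by
        rw [Ring.mul_inverse_cancel _ h, cayley]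
    _ = 2 * Ring.inverse (1 + a) := by rw [← add_mul]; congr 1; rw [← one_add_one_eq_two]; abel

/-- Solves b = (1 - a)(1 + a)⁻¹ for a: the relation gives a = (1 - b)(1 + b)⁻¹, which is why the
transform is an involution. -/
theorem one_sub_cayley {a : A} (h : IsUnit (1 + a)) :
    1 - cayley a = a * (1 + cayley a) := by
  calc 1 - cayley a = (1 + a) * Ring.inverse (1 + a) - (1 - a) * Ring.inverse (1 + a) := by
        rw [Ring.mul_inverse_cancel _ h, cayley]
    _ = a * (2 * Ring.inverse (1 + a)) := by
        rw [← sub_mul, ← mul_assoc]; congr 1; rw [mul_two]; abel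
    _ = _ := by rw [one_add_cayley h]

theorem isUnit_one_add_cayley [Invertible (2 : A)] {a : A} (h : IsUnit (1 + a)) :
    IsUnit (1 + cayley a) := by
  rw [one_add_cayley h]
  exact (isUnit_of_invertible 2).mul (isUnit_ringInverse.2 h)

theorem cayley_cayley [Invertible (2 : A)] {a : A} (h : IsUnit (1 + a)) :
    cayley (cayley a) = a := by
  rw [cayley, one_sub_cayley h, mul_assoc, Ring.mul_inverse_cancel _ (isUnit_one_add_cayley h),
    mul_one]

/-- The Cayley transform commutes with ring anti-homomorphisms. -/
theorem cayley_map_op (σ : A →+* Aᵐᵒᵖ) {a : A} (h : IsUnit (1 + a)) :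
    (σ (cayley a)).unop = cayley (σ a).unop := by
  have h1 : (σ (Ring.inverse (1 + a))).unop = Ring.inverse (1 + (σ a).unop) := by
    obtain ⟨u, hu⟩ := h
    have h2 : 1 + (σ a).unop = (σ (1 + a)).unop := by simp
    let v : Aˣ := ⟨(σ u).unop, (σ ↑u⁻¹).unop,
      by rw [← MulOpposite.unop_mul, ← map_mul]; simp, by rw [← MulOpposite.unop_mul, ← map_mul]; simp⟩
    rw [h2, ← hu, Ring.inverse_unit]
    exact (Ring.inverse_unit v).symm
  -- The two factors commute, so the reversal of products is harmless.
  rw [cayley, one_sub_mul_inverse_one_add h, map_mul, MulOpposite.unop_mul, h1, cayley]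
  simp

/-- Clearing both invertible denominators leaves (1 - a*)(1 + a) + (1 + a*)(1 - a) = 0, whose left
side is 2(1 - a*a). -/
theorem star_cayley_eq_neg_iff [StarRing A] [Invertible (2 : A)] {a : A} (h : IsUnit (1 + a)) :
    star (cayley a) = -cayley a ↔ star a * a = 1 := by
  have h' : IsUnit (1 + star a) := by simpa using h.star
  have h1 : star (cayley a) = Ring.inverse (1 + star a) * (1 - star a) := by
    have := cayley_map_op (starRingEquiv (R := A) : A →+* Aᵐᵒᵖ) h
    simp only [RingHom.coe_coe, starRingEquiv_apply, MulOpposite.unop_op] at this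
    rw [this, cayley, one_sub_mul_inverse_one_add h']
  have h2 : star (cayley a) = -cayley a ↔ (1 - star a) * (1 + a) = -((1 + star a) * (1 - a)) := by
    rw [h1, cayley]
    constructor
    · intro e
      calc (1 - star a) * (1 + a)
          = (1 + star a) * (Ring.inverse (1 + star a) * (1 - star a)) * (1 + a) := by
            rw [← mul_assoc, Ring.mul_inverse_cancel _ h', one_mul]
        _ = _ := by
            rw [e, mul_neg, neg_mul, mul_assoc, mul_assoc, Ring.inverse_mul_cancel _ h, mul_one]
    · intro e
      calc Ring.inverse (1 + star a) * (1 - star a)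
          = Ring.inverse (1 + star a) * ((1 - star a) * (1 + a)) * Ring.inverse (1 + a) := by
            rw [mul_assoc, mul_assoc, Ring.mul_inverse_cancel _ h, mul_one]
        _ = _ := by
            rw [e, mul_neg, neg_mul, ← mul_assoc, Ring.inverse_mul_cancel _ h', one_mul]
  have h3 : (1 - star a) * (1 + a) + (1 + star a) * (1 - a) = 2 * (1 - star a * a) := by
    noncomm_ring
  rw [h2, eq_neg_iff_add_eq_zero, h3, (isUnit_of_invertible (2 : A)).mul_right_eq_zero, sub_eq_zero,
    eq_comm]

end Algebra

variable {A : Type*} [NormedRing A] [NormedAlgebra ℝ A] [CompleteSpace A]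

theorem isOpen_isUnit_one_add {A : Type*} [NormedRing A] [CompleteSpace A] :
    IsOpen {a : A | IsUnit (1 + a)} :=
  Units.isOpen.preimage (continuous_const.add continuous_id)

theorem contDiffOn_cayley : ContDiffOn ℝ ∞ (cayley : A → A) {a | IsUnit (1 + a)} := by
  rintro a ⟨u, hu⟩
  refine ContDiffAt.contDiffWithinAt ?_
  refine (contDiffAt_const.sub contDiffAt_id).mul ?_
  have := contDiffAt_ringInverse ℝ (n := ∞) u
  rw [hu] at this
  exact this.comp a (contDiffAt_const.add contDiffAt_id)

/-- The Cayley transform as an involutive partial homeomorphism. -/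
def cayleyHomeomorph [Invertible (2 : A)] : OpenPartialHomeomorph A A where
  toFun := cayley
  invFun := cayley
  source := {a | IsUnit (1 + a)}
  target := {a | IsUnit (1 + a)}
  map_source' _ h := isUnit_one_add_cayley h
  map_target' _ h := isUnit_one_add_cayley h
  left_inv' _ h := cayley_cayley h
  right_inv' _ h := cayley_cayley h
  open_source := isOpen_isUnit_one_add
  open_target := isOpen_isUnit_one_add
  continuousOn_toFun := contDiffOn_cayley.continuousOn
  continuousOn_invFun := contDiffOn_cayley.continuousOn

/-- A set which is described by a linear condition on Cayley transforms after translating each of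
its points to `1` is sliced. -/
theorem isSliced_of_cayley {S : Set A} {F : Submodule ℝ A}
    (h : ∀ x ∈ S, ∃ u v : Aˣ, u * x * v = (1 : A) ∧
      ∀ y : A, IsUnit (1 + u * y * v) → (y ∈ S ↔ cayley (u * y * v) ∈ F)) : IsSliced S F := by
  intro x hx
  obtain ⟨u, v, h1, h2⟩ := h x hx
  let _ : Invertible (2 : A) := Invertible.copy (Invertible.map (algebraMap ℝ A) 2) _ (map_ofNat _ 2).symm
  -- The chart is the translation taking x to 1 followed by the Cayley transform, which is defined
  -- at 1 because 2 is invertible.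
  let t : A ≃ₜ A := ⟨⟨fun y => u * y * v, fun y => ↑u⁻¹ * y * ↑v⁻¹,
    fun y => by simp [mul_assoc], fun y => by simp [mul_assoc]⟩, by fun_prop, by fun_prop⟩
  refine ⟨t.toOpenPartialHomeomorph.trans cayleyHomeomorph, ?_, ?_, ?_, ?_⟩
  · refine ⟨trivial, ?_⟩
    change IsUnit (1 + u * x * v)
    rw [h1, one_add_one_eq_two]
    exact isUnit_of_invertible 2
  · refine contDiffOn_cayley.comp (ContDiff.contDiffOn ?_) ?_
    · exact (contDiff_const.mul contDiff_id).mul contDiff_const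
    · rintro y ⟨-, hy⟩
      exact hy
  · refine ContDiff.comp_contDiffOn (g := fun y : A => ↑u⁻¹ * y * ↑v⁻¹) ?_
      (contDiffOn_cayley.mono ?_)
    · exact (contDiff_const.mul contDiff_id).mul contDiff_const
    · rintro y ⟨hy, -⟩
      exact hy
  · rintro y ⟨-, hy⟩
    exact h2 y hy

end

end Cayley

namespace QLGr

/-! ### The symplectic adjoint -/

section SymplecticAdjoint

variable {n : ℕ}

theorem sAdj_mul (X Y : CMat n) : sAdj (X * Y) = sAdj Y * sAdj X := by
  have : Matrix.J (Fin n) ℂ * Yᵀ * Matrix.J (Fin n) ℂ * (Matrix.J (Fin n) ℂ * Xᵀ * Matrix.J (Fin n) ℂ)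
      = Matrix.J (Fin n) ℂ * Yᵀ * (Matrix.J (Fin n) ℂ * Matrix.J (Fin n) ℂ) * Xᵀ
        * Matrix.J (Fin n) ℂ := by
    simp only [mul_assoc]
  rw [sAdj, sAdj, sAdj, neg_mul_neg, this, Matrix.J_squared, Matrix.transpose_mul]
  simp [mul_assoc]

theorem sAdj_add (X Y : CMat n) : sAdj (X + Y) = sAdj X + sAdj Y := by
  simp [sAdj, mul_add, add_mul, add_comm]

theorem sAdj_smul (c : ℂ) (X : CMat n) : sAdj (c • X) = c • sAdj X := by
  simp [sAdj]

theorem sAdj_one : sAdj (1 : CMat n) = 1 := by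
  simp [sAdj, Matrix.J_squared]

theorem sAdj_sAdj (X : CMat n) : sAdj (sAdj X) = X := by
  have : Matrix.J (Fin n) ℂ * (Matrix.J (Fin n) ℂ * X * Matrix.J (Fin n) ℂ) * Matrix.J (Fin n) ℂ
      = (Matrix.J (Fin n) ℂ * Matrix.J (Fin n) ℂ) * X
        * (Matrix.J (Fin n) ℂ * Matrix.J (Fin n) ℂ) := by
    simp only [mul_assoc]
  have h : (Matrix.J (Fin n) ℂ * Xᵀ * Matrix.J (Fin n) ℂ)ᵀ
      = Matrix.J (Fin n) ℂ * X * Matrix.J (Fin n) ℂ := by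
    simp [Matrix.transpose_mul, Matrix.J_transpose, mul_assoc]
  rw [sAdj, sAdj, Matrix.transpose_neg, h, mul_neg, neg_mul, neg_neg, this, Matrix.J_squared]
  simp

theorem star_J : star (Matrix.J (Fin n) ℂ) = -Matrix.J (Fin n) ℂ := by
  rw [Matrix.star_eq_conjTranspose, Matrix.J, Matrix.fromBlocks_conjTranspose,
    Matrix.fromBlocks_neg]
  simp

theorem sAdj_star (X : CMat n) : sAdj (star X) = star (sAdj X) := by
  simp only [sAdj, star_neg, star_mul, star_J]
  simp only [Matrix.star_eq_conjTranspose, Matrix.conjTranspose, Matrix.transpose_map]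
  simp [mul_assoc]

/-- The symplectic adjoint as a ring anti-homomorphism. -/
noncomputable def sAdjRingHom (n : ℕ) : CMat n →+* (CMat n)ᵐᵒᵖ where
  toFun X := MulOpposite.op (sAdj X)
  map_one' := by rw [sAdj_one]; rfl
  map_mul' X Y := by rw [sAdj_mul]; rfl
  map_zero' := by
    have : sAdj (0 : CMat n) = 0 := by simp [sAdj]
    rw [this]; rfl
  map_add' X Y := by rw [sAdj_add]; rfl

theorem continuous_sAdj : Continuous (sAdj : CMat n → CMat n) :=
  ((continuous_const.mul continuous_id.matrix_transpose).mul continuous_const).neg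

theorem sAdj_pow (X : CMat n) (k : ℕ) : sAdj (X ^ k) = sAdj X ^ k := by
  induction k with
  | zero => simp [sAdj_one]
  | succ k ih => rw [pow_succ, sAdj_mul, ih, pow_succ']

/-- Powers of a single matrix commute, so the order reversal of S is invisible. This makes a
polynomial in a symmetric matrix symmetric. -/
theorem sAdj_aeval (p : Polynomial ℂ) (X : CMat n) :
    sAdj (Polynomial.aeval X p) = Polynomial.aeval (sAdj X) p := by
  induction p using Polynomial.induction_on' with
  | add p q hp hq => rw [map_add, map_add, sAdj_add, hp, hq]
  | monomial k c =>
    rw [Polynomial.aeval_monomial, Polynomial.aeval_monomial, ← Algebra.smul_def, sAdj_smul,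
      sAdj_pow, Algebra.smul_def]

theorem sAdj_mem_unitary {Q : CMat n} (h : Q ∈ U2 n) : sAdj Q ∈ U2 n := by
  rw [Matrix.mem_unitaryGroup_iff, ← sAdj_star, ← sAdj_mul, Unitary.star_mul_self_of_mem h, sAdj_one]

theorem mul_sAdj_eq_one_iff (A : CMat n) :
    A * sAdj A = 1 ↔ A ∈ Matrix.symplecticGroup (Fin n) ℂ := by
  rw [SymplecticGroup.mem_iff]
  have h1 : A * sAdj A = -(A * Matrix.J (Fin n) ℂ * Aᵀ * Matrix.J (Fin n) ℂ) := by
    simp [sAdj, mul_assoc]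
  rw [h1]
  constructor
  · intro h
    have h2 := congrArg (· * Matrix.J (Fin n) ℂ) h
    simpa [mul_assoc, Matrix.J_squared] using h2
  · intro h
    rw [h, Matrix.J_squared, neg_neg]

theorem mul_sAdj_mem_unitary {Q : CMat n} (h : Q ∈ U2 n) : Q * sAdj Q ∈ U2 n :=
  mul_mem h (sAdj_mem_unitary h)

theorem sAdj_mul_sAdj_self (Q : CMat n) : sAdj (Q * sAdj Q) = Q * sAdj Q := by
  rw [sAdj_mul, sAdj_sAdj]

theorem sAdj_conj (A X : CMat n) : sAdj (A * X * sAdj A) = A * sAdj X * sAdj A := by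
  rw [sAdj_mul, sAdj_mul, sAdj_sAdj, mul_assoc]

end SymplecticAdjoint

/-! ### Square roots, slice charts and local sections for unitary matrices, in the operator norm -/

section NormedMatrices

open scoped Matrix.Norms.L2Operator Topology

/-- A unitary matrix has a unitary square root which is a polynomial in it. -/
theorem exists_polynomial_sqrt {m : Type*} [Fintype m] [DecidableEq m] {X : Matrix m m ℂ}
    (hX : X ∈ Matrix.unitaryGroup m ℂ) : ∃ p : Polynomial ℂ,
      Polynomial.aeval X p ∈ Matrix.unitaryGroup m ℂ ∧
        Polynomial.aeval X p * Polynomial.aeval X p = X := by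
  have hn : IsStarNormal X := ⟨by
    rw [Commute, SemiconjBy, Unitary.star_mul_self_of_mem hX, Unitary.mul_star_self_of_mem hX]⟩
  let s := (Matrix.finite_spectrum X).toFinset
  -- The spectrum is finite, so the principal square root agrees on it with a polynomial. No
  -- continuity of the root is needed.
  let p : Polynomial ℂ := Lagrange.interpolate s id fun z => z ^ (1 / 2 : ℂ)
  have hp : ∀ z ∈ spectrum ℂ X, p.eval z = z ^ (1 / 2 : ℂ) := fun z hz =>
    Lagrange.eval_interpolate_at_node (v := id) _ (Set.injOn_id _)
      ((Matrix.finite_spectrum X).mem_toFinset.2 hz)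
  have hsq : ∀ z ∈ spectrum ℂ X, p.eval z * p.eval z = z := fun z hz => by
    rw [hp z hz, ← sq, ← Complex.cpow_nat_mul]
    norm_num
  have hcont : ContinuousOn (fun z => p.eval z) (spectrum ℂ X) := p.continuous.continuousOn
  refine ⟨p, ?_, ?_⟩
  · rw [← cfc_polynomial p X]
    refine (cfc_unitary_iff _ X hn hcont).2 fun z hz => ?_
    have hz1 : ‖z‖ = 1 := spectrum.norm_eq_one_of_unitary (𝕜 := ℂ) hX hz
    have h2 : ‖p.eval z‖ * ‖p.eval z‖ = 1 := by rw [← norm_mul, hsq z hz, hz1]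
    rw [Complex.star_def, Complex.conj_mul', sq, ← Complex.ofReal_mul, h2, Complex.ofReal_one]
  · rw [← cfc_polynomial p X, ← cfc_mul _ _ X hcont hcont, cfc_congr (g := id) fun z hz => hsq z hz,
      cfc_id ℂ X]

variable {n : ℕ}

/-- For the harder inclusion, the root Q = p(X) satisfies Q^S = p(X^S) = Q, so X = QQ = QQ^S. -/
theorem squares_eq : squares n = {X : CMat n | X ∈ U2 n ∧ X = sAdj X} := by
  ext X
  constructor
  · rintro ⟨Q, hQ, rfl⟩
    exact ⟨mul_sAdj_mem_unitary hQ, (sAdj_mul_sAdj_self Q).symm⟩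
  · rintro ⟨h1, h2⟩
    obtain ⟨p, hp1, hp2⟩ := exists_polynomial_sqrt h1
    exact ⟨_, hp1, by rw [sAdj_aeval, ← h2, hp2]⟩

instance : CompactSpace (U2 n) := by
  refine isCompact_iff_compactSpace (s := (U2 n : Set (CMat n))).1 ?_
  refine Metric.isCompact_of_isClosed_isBounded ?_ ?_
  · exact isClosed_unitary
  · refine Metric.isBounded_iff_subset_closedBall 0 |>.2 ⟨1, fun X hX => ?_⟩
    rw [mem_closedBall_zero_iff]
    rcases subsingleton_or_nontrivial (CMat n) with h | h
    · rw [Subsingleton.elim X 0, norm_zero]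
      exact zero_le_one
    · exact (CStarRing.norm_of_mem_unitary hX).le

/-- The unitary group is sliced by the skew-Hermitian matrices. -/
theorem isSliced_unitary :
    IsSliced (U2 n : Set (CMat n)) (skewAdjoint.submodule ℝ (CMat n)) := by
  refine isSliced_of_cayley fun Q hQ => ?_
  let _ : Invertible (2 : CMat n) := Invertible.copy (Invertible.map (algebraMap ℝ _) 2) _
    (map_ofNat _ 2).symm
  refine ⟨Unitary.toUnits ⟨star Q, Unitary.star_mem hQ⟩, 1, ?_, fun Y hY => ?_⟩
  · simpa using Unitary.star_mul_self_of_mem hQ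
  · simp only [Unitary.val_toUnits_apply, Units.val_one, mul_one] at hY ⊢
    have h1 : cayley (star Q * Y) ∈ skewAdjoint.submodule ℝ (CMat n) ↔
        star (cayley (star Q * Y)) = -cayley (star Q * Y) := Iff.rfl
    rw [h1, star_cayley_eq_neg_iff hY, star_mul, star_star, mul_assoc, ← mul_assoc Q,
      Unitary.mul_star_self_of_mem hQ, one_mul]
    exact Matrix.mem_unitaryGroup_iff'

/-- The tangent space at `1` of the set of symplectically symmetric unitary matrices. -/
noncomputable def skewSymm (n : ℕ) : Submodule ℝ (CMat n) :=
  skewAdjoint.submodule ℝ (CMat n) ⊓ (Y2 n).restrictScalars ℝ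

/-- The translation Y ↦ Q* Y (Q*)^S preserves the set and takes QQ^S to 1. The Cayley transform
commutes with S, so both defining conditions become linear. -/
theorem isSliced_squares : IsSliced (squares n) (skewSymm n) := by
  refine isSliced_of_cayley ?_
  rintro _ ⟨Q, hQ, rfl⟩
  let _ : Invertible (2 : CMat n) := Invertible.copy (Invertible.map (algebraMap ℝ _) 2) _
    (map_ofNat _ 2).symm
  have hQ1 := Unitary.mul_star_self_of_mem hQ
  have hQ2 := Unitary.star_mul_self_of_mem hQ
  have hS1 : sAdj Q * sAdj (star Q) = 1 := by rw [← sAdj_mul, hQ2, sAdj_one]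
  have hS2 : sAdj (star Q) * sAdj Q = 1 := by rw [← sAdj_mul, hQ1, sAdj_one]
  have hQs := Unitary.star_mem hQ
  refine ⟨Unitary.toUnits ⟨star Q, hQs⟩, Unitary.toUnits ⟨sAdj (star Q), sAdj_mem_unitary hQs⟩,
    ?_, fun Y hY => ?_⟩
  · simp only [Unitary.val_toUnits_apply]
    rw [← mul_assoc, hQ2, one_mul, hS1]
  · simp only [Unitary.val_toUnits_apply] at hY ⊢
    set Z := star Q * Y * sAdj (star Q) with hZ
    have hYZ : Y = Q * Z * sAdj Q := by
      rw [hZ, ← mul_assoc, ← mul_assoc, hQ1, one_mul, mul_assoc, hS2, mul_one]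
    have h1 : Y ∈ U2 n ↔ Z ∈ U2 n :=
      ⟨fun h => mul_mem (mul_mem hQs h) (sAdj_mem_unitary hQs), fun h => by
        rw [hYZ]; exact mul_mem (mul_mem hQ h) (sAdj_mem_unitary hQ)⟩
    have h2 : Y = sAdj Y ↔ Z = sAdj Z :=
      ⟨fun h => by rw [hZ, sAdj_conj, ← h], fun h => by rw [hYZ, sAdj_conj, ← h]⟩
    have h3 : cayley Z ∈ skewSymm n ↔ star (cayley Z) = -cayley Z ∧ cayley Z = sAdj (cayley Z) :=
      Iff.rfl
    have h4 : IsUnit (1 + sAdj Z) := by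
      have : 1 + sAdj Z = sAdj (1 + Z) := by rw [sAdj_add, sAdj_one]
      obtain ⟨u, hu⟩ := hY
      rw [this, ← hu]
      refine ⟨⟨sAdj u, sAdj ↑u⁻¹, ?_, ?_⟩, rfl⟩ <;> rw [← sAdj_mul] <;> simp [sAdj_one]
    have h5 : sAdj (cayley Z) = cayley (sAdj Z) := cayley_map_op (sAdjRingHom n) hY
    rw [squares_eq, Set.mem_ofPred_eq, h1, h2, h3, star_cayley_eq_neg_iff hY, h5,
      Matrix.mem_unitaryGroup_iff']
    refine and_congr_right fun _ => ⟨fun h => by rw [← h], fun h => ?_⟩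
    exact (cayley_cayley hY).symm.trans ((congrArg cayley h).trans (cayley_cayley h4))

/-- A smooth local square root on the symplectically symmetric unitary matrices near `1`. -/
theorem exists_local_sqrt (n : ℕ) : ∃ (r : CMat n → CMat n) (V : Set (CMat n)), IsOpen V ∧ 1 ∈ V ∧
    ContDiffOn ℝ ∞ r V ∧ ∀ Y ∈ V, Y ∈ squares n → r Y ∈ U2 n ∧ r Y * sAdj (r Y) = Y := by
  let f : CMat n → CMat n := fun X => X * X
  -- The class `ω` matters: unlike `∞`, regularity of this class at a point persists on a
  -- neighbourhood, as `hr.eventually` requires.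
  have hf : ContDiff ℝ ω f := contDiff_id.mul contDiff_id
  let f' : CMat n ≃L[ℝ] CMat n := ContinuousLinearEquiv.smulLeft (Units.mk0 (2 : ℝ) two_ne_zero)
  have hf' : HasFDerivAt f (f' : CMat n →L[ℝ] CMat n) 1 := by
    have := (hasFDerivAt_id (𝕜 := ℝ) (1 : CMat n)).mul' (hasFDerivAt_id (𝕜 := ℝ) (1 : CMat n))
    convert! this using 1
    ext X : 1
    simp [f', two_smul, Units.smul_def]
  have hω : (ω : ℕ∞ω) ≠ 0 := by simp
  let e := hf.contDiffAt.toOpenPartialHomeomorph f hf' hω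
  have he : ∀ X, e X = X * X := fun X => rfl
  have h1s : (1 : CMat n) ∈ e.source := hf.contDiffAt.mem_toOpenPartialHomeomorph_source hf' hω
  have h1t : (1 : CMat n) ∈ e.target := by
    have := e.map_source h1s
    rwa [he, mul_one] at this
  have hr1 : e.symm 1 = 1 := by
    have := e.left_inv h1s
    rwa [he, mul_one] at this
  have hr : ContDiffAt ℝ ω e.symm 1 := by
    have := hf.contDiffAt.to_localInverse hf' hω
    have h11 : f 1 = 1 := mul_one 1
    rwa [h11] at this
  have hc := hr.continuousAt
  -- Near 1, both q^S and (q*)⁻¹ stay in the region where squaring is injective. If Y is symmetric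
  -- and unitary, both square to Y, so both equal the root q.
  have ev1 : ∀ᶠ Y in 𝓝 (1 : CMat n), sAdj (e.symm Y) ∈ e.source := by
    refine (continuous_sAdj.continuousAt.comp hc).eventually_mem (e.open_source.mem_nhds ?_)
    simpa [hr1, sAdj_one] using h1s
  have ev2 : ∀ᶠ Y in 𝓝 (1 : CMat n), Ring.inverse (star (e.symm Y)) ∈ e.source := by
    have hi : ContinuousAt Ring.inverse (star (e.symm (1 : CMat n))) := by
      rw [hr1, star_one]
      exact NormedRing.inverse_continuousAt 1
    refine (hi.comp (f := fun Y => star (e.symm Y)) hc.star).eventually_mem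
      (e.open_source.mem_nhds ?_)
    simpa [hr1] using h1s
  have ev := (((hr.eventually (by simp)).and (e.open_target.eventually_mem h1t)).and ev1).and ev2
  obtain ⟨V, hV, hVo, h1V⟩ := eventually_nhds_iff.1 ev
  refine ⟨e.symm, V, hVo, h1V, fun Y hY =>
    ((hV Y hY).1.1.1.of_le le_top).contDiffWithinAt, fun Y hY hYs => ?_⟩
  obtain ⟨⟨⟨-, ht⟩, hs1⟩, hs2⟩ := hV Y hY
  rw [squares_eq] at hYs
  obtain ⟨hYu, hYS⟩ := hYs
  have hq : e.symm Y * e.symm Y = Y := e.right_inv ht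
  set q := e.symm Y
  have hqs : q ∈ e.source := e.map_target ht
  have h1 : sAdj q = q := by
    refine e.injOn hs1 hqs ?_
    rw [he, he, ← sAdj_mul, hq, ← hYS]
  have hYq : IsUnit q := by
    refine IsUnit.of_mul_eq_one (q * star Y) ?_
    rw [← mul_assoc, hq, Unitary.mul_star_self_of_mem hYu]
  have h2 : Ring.inverse (star q) = q := by
    refine e.injOn hs2 hqs ?_
    rw [he, he, ← Ring.inverse_mul (Or.inl hYq.star), ← star_mul, hq]
    have : Ring.inverse (star Y) = Y := by
      have := Ring.inverse_unit (Unitary.toUnits ⟨star Y, Unitary.star_mem hYu⟩)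
      simpa using this
    exact this
  refine ⟨?_, by rw [h1, hq]⟩
  rw [Matrix.mem_unitaryGroup_iff']
  nth_rewrite 2 [← h2]
  exact Ring.mul_inverse_cancel _ hYq.star

/-! ### The homogeneous space -/

/-- The map `[Q] ↦ Q Q^S` on the homogeneous space `U(2n)/Sp(n)`. -/
noncomputable def quotSquare (n : ℕ) : U2 n ⧸ Sp n → CMat n :=
  Quotient.lift (fun Q : U2 n => (Q : CMat n) * sAdj Q) fun P Q h => by
    have h1 : P⁻¹ * Q ∈ Sp n := QuotientGroup.leftRel_apply.1 h
    obtain ⟨A, hA, rfl⟩ : ∃ A ∈ Sp n, Q = P * A := ⟨_, h1, by simp⟩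
    have hA' := (mul_sAdj_eq_one_iff (A : CMat n)).2 hA
    simp only [Submonoid.coe_mul, sAdj_mul]
    rw [mul_assoc, ← mul_assoc (A : CMat n), hA', one_mul]

theorem quotSquare_mk (Q : U2 n) : quotSquare n (QuotientGroup.mk Q) = (Q : CMat n) * sAdj Q := rfl

theorem range_quotSquare : Set.range (quotSquare n) = squares n := by
  ext X
  constructor
  · rintro ⟨q, rfl⟩
    obtain ⟨Q, rfl⟩ := QuotientGroup.mk_surjective q
    exact ⟨Q, Q.2, rfl⟩
  · rintro ⟨Q, hQ, rfl⟩
    exact ⟨QuotientGroup.mk ⟨Q, hQ⟩, rfl⟩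

/-- Writing Q = PA, the equality PP^S = P(AA^S)P^S cancels to AA^S = 1, which says that A is
symplectic. -/
theorem quotSquare_injective : Function.Injective (quotSquare n) := by
  intro p q h
  obtain ⟨P, rfl⟩ := QuotientGroup.mk_surjective p
  obtain ⟨Q, rfl⟩ := QuotientGroup.mk_surjective q
  obtain ⟨A, rfl⟩ : ∃ A, Q = P * A := ⟨P⁻¹ * Q, by simp⟩
  rw [QuotientGroup.eq, inv_mul_cancel_left]
  refine (mul_sAdj_eq_one_iff (A : CMat n)).1 ?_
  simp only [quotSquare_mk, Submonoid.coe_mul, sAdj_mul] at h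
  have h1 : (P : CMat n) * 1 * sAdj (P : CMat n)
      = P * ((A : CMat n) * sAdj (A : CMat n)) * sAdj (P : CMat n) := by
    simpa [mul_assoc] using h
  have hP := Unitary.star_mul_self_of_mem P.2
  have hP' : sAdj (P : CMat n) * sAdj (star (P : CMat n)) = 1 := by rw [← sAdj_mul, hP, sAdj_one]
  have h2 := congrArg (fun Z => star (P : CMat n) * Z * sAdj (star (P : CMat n))) h1
  have h3 : ∀ Z : CMat n, star (P : CMat n) * (P * Z * sAdj (P : CMat n)) * sAdj (star (P : CMat n))
      = Z := fun Z => by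
    rw [mul_assoc, mul_assoc, hP', mul_one, ← mul_assoc, hP, one_mul]
  rw [h3, h3] at h2
  exact h2.symm

/-- A continuous injection from a compact space to a Hausdorff space is a closed embedding. -/
theorem isEmbedding_quotSquare : Topology.IsEmbedding (quotSquare n) := by
  have hc : Continuous (quotSquare n) := continuous_quot_lift _
    (continuous_subtype_val.mul (continuous_sAdj.comp continuous_subtype_val))
  exact (hc.isClosedEmbedding quotSquare_injective).isEmbedding

theorem quotSquare_smul (A : U2 n) (q : U2 n ⧸ Sp n) :
    quotSquare n (A • q) = (A : CMat n) * quotSquare n q * sAdj (A : CMat n) := by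
  obtain ⟨Q, rfl⟩ := QuotientGroup.mk_surjective q
  change quotSquare n (QuotientGroup.mk (A * Q)) = _
  simp only [quotSquare_mk, Submonoid.coe_mul, sAdj_mul, mul_assoc]

end NormedMatrices

end QLGr

namespace QLGr

/-! ### Linear algebra over the quaternions -/

section QuaternionicVectors

open MulOpposite

variable {n : ℕ}

/-- The quaternion unit `j`. -/
def quatJ : ℍ[ℝ] := ⟨0, 0, 1, 0⟩

@[simp] theorem quatJ_re : quatJ.re = 0 := rfl

@[simp] theorem quatJ_imI : quatJ.imI = 0 := rfl

@[simp] theorem quatJ_imJ : quatJ.imJ = 1 := rfl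

@[simp] theorem quatJ_imK : quatJ.imK = 0 := rfl

theorem inner_mul_quaternion (q x y : ℍ[ℝ]) : inner ℝ (q * x) y = inner ℝ x (star q * y) := by
  simp [Quaternion.inner_def]
  ring

theorem inner_quaternion_mul (x q y : ℍ[ℝ]) : inner ℝ (x * q) y = inner ℝ x (y * star q) := by
  simp [Quaternion.inner_def]
  ring

/-- Multiplication by `j` from the left. -/
noncomputable def jMul (n : ℕ) : HVec n →ₗ[ℍ[ℝ]ᵐᵒᵖ] HVec n where
  toFun x := WithLp.toLp 2 (fun a => quatJ * x a)
  map_add' x y := by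
    ext1 a
    simp [mul_add]
  map_smul' c x := by
    ext1 a
    simp [mul_assoc]

theorem jMul_apply (x : HVec n) (a : Fin n ⊕ Fin n) : jMul n x a = quatJ * x a := rfl

theorem jMul_jMul (x : HVec n) : jMul n (jMul n x) = -x := by
  ext1 a
  have : quatJ * quatJ = -1 := by ext <;> simp
  simp [jMul_apply, ← mul_assoc, this]

theorem quatJ_mul_coe (z : ℂ) : quatJ * (z : ℍ[ℝ]) = ((star z : ℂ) : ℍ[ℝ]) * quatJ := by
  ext <;> simp

theorem jMul_act (A : CMat n) (x : HVec n) : jMul n (act A x) = act (A.map star) (jMul n x) := by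
  ext1 a
  simp only [jMul_apply, act_apply, Finset.mul_sum, Matrix.map_apply]
  refine Finset.sum_congr rfl fun b _ => ?_
  rw [← mul_assoc, quatJ_mul_coe, mul_assoc]

theorem inner_act (A : CMat n) (x y : HVec n) :
    inner ℝ (act A x) y = inner ℝ x (act (star A) y) := by
  simp only [PiLp.inner_apply, act_apply, sum_inner, inner_sum]
  rw [Finset.sum_comm]
  refine Finset.sum_congr rfl fun b _ => Finset.sum_congr rfl fun a _ => ?_
  rw [inner_mul_quaternion, Matrix.star_apply, coe_star]

theorem inner_jMul (x y : HVec n) : inner ℝ (jMul n x) y = -inner ℝ x (jMul n y) := by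
  simp only [PiLp.inner_apply, jMul_apply, ← Finset.sum_neg_distrib]
  refine Finset.sum_congr rfl fun a _ => ?_
  have : star quatJ = -quatJ := by ext <;> simp
  rw [inner_mul_quaternion, this, neg_mul, inner_neg_right]

theorem inner_op_smul (q : ℍ[ℝ]) (x y : HVec n) :
    inner ℝ (op q • x) y = inner ℝ x (op (star q) • y) := by
  simp only [PiLp.inner_apply]
  refine Finset.sum_congr rfl fun a _ => ?_
  exact inner_quaternion_mul _ _ _

theorem act_mul_apply (A B : CMat n) (x : HVec n) : act A (act B x) = act (A * B) x := by
  rw [act_mul]; rfl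

theorem act_add (A B : CMat n) (x : HVec n) : act (A + B) x = act A x + act B x := by
  ext1 a
  simp [act_apply, add_mul, Finset.sum_add_distrib]

theorem act_real_smul (c : ℝ) (A : CMat n) (x : HVec n) : act (c • A) x = c • act A x := by
  ext1 a
  have : ∀ z : ℂ, ((c • z : ℂ) : ℍ[ℝ]) = c • (z : ℍ[ℝ]) := fun z => by ext <;> simp
  simp only [act_apply, PiLp.smul_apply, Finset.smul_sum, Matrix.smul_apply, this, smul_mul_assoc]

theorem act_neg (A : CMat n) (x : HVec n) : act (-A) x = -act A x := by
  ext1 a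
  have : ∀ z : ℂ, ((-z : ℂ) : ℍ[ℝ]) = -(z : ℍ[ℝ]) := fun z => by ext <;> simp
  simp [act_apply, this]

/-- The standard basis vectors of `ℍ²ⁿ`. -/
noncomputable def stdVec (b : Fin n ⊕ Fin n) : HVec n := WithLp.toLp 2 (Pi.single b 1)

theorem stdVec_apply (a b : Fin n ⊕ Fin n) : stdVec b a = if a = b then 1 else 0 := by
  simp [stdVec]

theorem sum_stdVec (x : HVec n) : ∑ b, op (x b) • stdVec b = x := by
  ext1 a
  simp [stdVec_apply, -Fintype.sum_sum_type]

theorem act_stdVec (A : CMat n) (a b : Fin n ⊕ Fin n) : act A (stdVec b) a = ((A a b : ℂ) : ℍ[ℝ]) := by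
  simp [act_apply, stdVec_apply]

theorem act_injective {A B : CMat n} (h : ∀ x, act A x = act B x) : A = B := by
  ext a b
  have h1 : ((A a b : ℂ) : ℍ[ℝ]) = ((B a b : ℂ) : ℍ[ℝ]) := by
    rw [← act_stdVec, h, act_stdVec]
  exact Complex.ext (by simpa using congrArg (·.re) h1) (by simpa using congrArg (·.imI) h1)

/-- A quaternionic linear map is the sum of a complex matrix and a complex matrix times `j`. -/
theorem exists_act_add_act_jMul (M : HVec n →ₗ[ℍ[ℝ]ᵐᵒᵖ] HVec n) :
    ∃ A B : CMat n, ∀ x, M x = act A x + act B (jMul n x) := by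
  refine ⟨Matrix.of fun a b => ⟨(M (stdVec b) a).re, (M (stdVec b) a).imI⟩,
    Matrix.of fun a b => ⟨(M (stdVec b) a).imJ, (M (stdVec b) a).imK⟩, fun x => ?_⟩
  -- Since ij = k, every quaternion is z + wj with z, w complex. Applied to the entries of M on the
  -- standard basis, this yields A and B.
  have hq : ∀ q : ℍ[ℝ], q = ((⟨q.re, q.imI⟩ : ℂ) : ℍ[ℝ]) + ((⟨q.imJ, q.imK⟩ : ℂ) : ℍ[ℝ]) * quatJ :=
    fun q => by ext <;> simp
  have h1 : M x = ∑ b, op (x b) • M (stdVec b) := by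
    conv_lhs => rw [← sum_stdVec x]
    simp [map_sum]
  ext1 a
  rw [h1]
  simp only [WithLp.ofLp_sum, Finset.sum_apply, PiLp.add_apply, act_apply, jMul_apply, Matrix.of_apply,
    ← Finset.sum_add_distrib]
  refine Finset.sum_congr rfl fun b _ => ?_
  change M (stdVec b) a * x b = _
  conv_lhs => rw [hq (M (stdVec b) a)]
  rw [add_mul, mul_assoc]

/-! ### Lagrangian subspaces and reflections -/

/-- Multiplication by `i` from the left. -/
noncomputable def iMul : HVec n →ₗ[ℍ[ℝ]ᵐᵒᵖ] HVec n := act (Complex.I • (1 : CMat n))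

theorem iMul_iMul (x : HVec n) : iMul (iMul x) = -x := by
  rw [iMul, act_mul_apply]
  have : (Complex.I • (1 : CMat n)) * (Complex.I • (1 : CMat n)) = -1 := by
    simp [smul_smul]
  rw [this, act_neg, act_one, LinearMap.id_apply]

theorem inner_iMul (x y : HVec n) : inner ℝ (iMul x) y = -inner ℝ x (iMul y) := by
  have : star (Complex.I • (1 : CMat n)) = -(Complex.I • 1) := by simp
  rw [iMul, inner_act, this, act_neg, inner_neg_right]

theorem skewForm_re (x y : HVec n) : (skewForm x y).re = inner ℝ x (iMul y) := by
  have h1 : ∀ a, (iMul y) a = ((Complex.I : ℂ) : ℍ[ℝ]) * y a := fun a => by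
    simp [iMul, act_apply, -Fintype.sum_sum_type, Matrix.one_apply, apply_ite Quaternion.coeComplex]
  have h2 : ∀ p q : ℍ[ℝ], (star p * ((Complex.I : ℂ) : ℍ[ℝ]) * q).re
      = inner ℝ p (((Complex.I : ℂ) : ℍ[ℝ]) * q) := fun p q => by
    simp [Quaternion.inner_def]
    ring
  have h3 : ∀ f : Fin n ⊕ Fin n → ℍ[ℝ], (∑ a, f a).re = ∑ a, (f a).re := fun f =>
    map_sum (⟨⟨fun q => q.re, rfl⟩, fun _ _ => rfl⟩ : ℍ[ℝ] →+ ℝ) f Finset.univ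
  simp only [skewForm, PiLp.inner_apply, h1, h3, h2]

theorem skewForm_op_smul (x y : HVec n) (q : ℍ[ℝ]) : skewForm x (op q • y) = skewForm x y * q := by
  simp [skewForm, Finset.sum_mul, mul_assoc, -Fintype.sum_sum_type]

/-- The Lagrangian condition in terms of the real inner product. -/
theorem isLagrangian_iff (W : Submodule ℍ[ℝ]ᵐᵒᵖ (HVec n)) :
    IsLagrangian W ↔ ∀ x, x ∈ W ↔ ∀ y ∈ W, inner ℝ x (iMul y) = 0 := by
  refine forall_congr' fun x => iff_congr Iff.rfl ⟨fun h y hy => ?_, fun h y hy => ?_⟩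
  · rw [← skewForm_re, h y hy, Quaternion.re_zero]
  -- Replacing y by y times the conjugate of ω(x, y), still in W, makes the real part equal to |ω(x,
  -- y)|². So vanishing real parts on W suffice.
  · have h1 := h _ (W.smul_mem (op (star (skewForm x y))) hy)
    rw [← skewForm_re, skewForm_op_smul, Quaternion.self_mul_star, Quaternion.re_coe] at h1
    exact Quaternion.normSq_eq_zero.1 h1

/-- Skew-symmetric unitary matrices. -/
def IsSkewUnitary (B : CMat n) : Prop := B * star B = 1 ∧ Bᵀ = -B

/-- J is unitary with J² = -1, and (-XJ)ᵀ = JXᵀ; skew-symmetry thus reads JXᵀ = XJ, that is X =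
-JXᵀJ. -/
theorem isSkewUnitary_iff (X : CMat n) :
    IsSkewUnitary (-(X * Matrix.J (Fin n) ℂ)) ↔ X ∈ squares n := by
  have hJ := Matrix.J_squared (Fin n) ℂ
  have h1 : -(X * Matrix.J (Fin n) ℂ) * star (-(X * Matrix.J (Fin n) ℂ)) = X * star X := by
    rw [star_neg, star_mul, star_J, neg_mul_neg, neg_mul, mul_neg, mul_assoc,
      ← mul_assoc (Matrix.J (Fin n) ℂ), hJ]
    simp
  rw [IsSkewUnitary, h1, squares_eq, Set.mem_ofPred_eq, Matrix.mem_unitaryGroup_iff, neg_neg,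
    Matrix.transpose_neg, Matrix.transpose_mul, Matrix.J_transpose, neg_mul, neg_neg]
  refine and_congr_right fun _ => ⟨fun h => ?_, fun h => ?_⟩
  · rw [sAdj, h, mul_assoc, hJ]
    simp
  · nth_rewrite 2 [h]
    rw [sAdj, neg_mul, mul_assoc _ _ (Matrix.J (Fin n) ℂ), hJ]
    simp

/-- The real adjoint of the map `B j` given by a complex matrix `B`. -/
theorem inner_act_jMul (B : CMat n) (x y : HVec n) :
    inner ℝ (act B (jMul n x)) y = -inner ℝ x (act Bᵀ (jMul n y)) := by
  have : (star B).map star = Bᵀ := by ext a b; simp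
  rw [inner_act, inner_jMul, jMul_act, this]

theorem act_jMul_act_jMul (B : CMat n) (x : HVec n) :
    act B (jMul n (act B (jMul n x))) = -act (B * B.map star) x := by
  rw [jMul_act, jMul_jMul, map_neg, map_neg, act_mul_apply]

theorem act_jMul_iMul (B : CMat n) (x : HVec n) :
    act B (jMul n (iMul x)) = -iMul (act B (jMul n x)) := by
  have h : (Complex.I • (1 : CMat n)).map star = -(Complex.I • 1) := by
    ext a b
    simp [Matrix.one_apply, apply_ite]
  rw [iMul, jMul_act, h, act_neg, map_neg, act_mul_apply, act_mul_apply]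
  simp

theorem IsSkewUnitary.map_star {B : CMat n} (h : IsSkewUnitary B) : B.map star = -star B := by
  have : B.map star = star Bᵀ := by ext a b; simp
  rw [this, h.2, star_neg]

theorem IsSkewUnitary.involutive {B : CMat n} (h : IsSkewUnitary B) (x : HVec n) :
    act B (jMul n (act B (jMul n x))) = x := by
  rw [act_jMul_act_jMul, h.map_star, mul_neg, act_neg, neg_neg, h.1, act_one, LinearMap.id_apply]

theorem proj_apply_eq {W : LGr n} {x w : HVec n} (hw : w ∈ W.1)
    (h : ∀ y ∈ W.1, inner ℝ (x - w) y = 0) : proj W x = w :=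
  Submodule.eq_starProjection_of_mem_of_inner_eq_zero (K := W.1.restrictScalars ℝ) hw h

theorem proj_mem (W : LGr n) (x : HVec n) : proj W x ∈ W.1 :=
  Submodule.starProjection_apply_mem (W.1.restrictScalars ℝ) x

theorem inner_sub_proj (W : LGr n) (x : HVec n) {y : HVec n} (hy : y ∈ W.1) :
    inner ℝ (x - proj W x) y = 0 :=
  Submodule.starProjection_inner_eq_zero (K := W.1.restrictScalars ℝ) x y hy

theorem proj_injective : Function.Injective (proj : LGr n → _) := by
  have h : ∀ (V W : LGr n), proj V = proj W → V.1 ≤ W.1 := fun V W h x hx => by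
    have : proj V x = x := proj_apply_eq hx (by simp)
    rw [← this, h]
    exact proj_mem W x
  exact fun V W hVW => Subtype.ext (le_antisymm (h V W hVW) (h W V hVW.symm))

/-- R = Bj is a symmetric involution anticommuting with i. Its ±1 eigenspaces are orthogonal and
exchanged by i, so the +1 eigenspace W is Lagrangian. -/
theorem exists_lagrangian_of_isSkewUnitary {B : CMat n} (hB : IsSkewUnitary B) :
    ∃ W : LGr n, ∀ x, proj W x = (1 / 2 : ℝ) • (x + act B (jMul n x)) := by
  have hsym : ∀ x y : HVec n, inner ℝ (act B (jMul n x)) y = inner ℝ x (act B (jMul n y)) :=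
    fun x y => by rw [inner_act_jMul, hB.2, act_neg, inner_neg_right, neg_neg]
  let W : Submodule ℍ[ℝ]ᵐᵒᵖ (HVec n) := LinearMap.eqLocus (act B ∘ₗ jMul n) LinearMap.id
  have hW : ∀ x, x ∈ W ↔ act B (jMul n x) = x := fun x => Iff.rfl
  have hreal : ∀ (c : ℝ) (x : HVec n), act B (jMul n (c • x)) = c • act B (jMul n x) :=
    fun c x => by rw [LinearMap.map_smul_of_tower, LinearMap.map_smul_of_tower]
  have horth : ∀ x y : HVec n, act B (jMul n x) = -x → y ∈ W → inner ℝ x y = 0 := by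
    intro x y hx hy
    have h1 := hsym x y
    rw [hx, (hW y).1 hy, inner_neg_left] at h1
    linarith
  have hL : IsLagrangian W := by
    rw [isLagrangian_iff]
    intro x
    constructor
    · intro hx y hy
      rw [real_inner_comm]
      exact horth _ _ (by rw [act_jMul_iMul, (hW y).1 hy]) hx
    · intro h
      -- z lies in the -1 eigenspace, so iz is in W. Testing x against it gives ⟨x, z⟩ = 0, and
      -- symmetry gives ⟨Rx, z⟩ = 0; hence z = 0.
      let z := x - act B (jMul n x)
      have hz : act B (jMul n z) = -z := by
        simp only [z, map_sub, hB.involutive, neg_sub]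
      have h1 : iMul z ∈ W := by rw [hW, act_jMul_iMul, hz, ← map_neg, neg_neg]
      have h2 := h _ h1
      rw [iMul_iMul, inner_neg_right, neg_eq_zero] at h2
      have h3 : inner ℝ (act B (jMul n x)) z = 0 := by rw [hsym, hz, inner_neg_right, h2, neg_zero]
      have h4 : inner ℝ z z = 0 := by
        nth_rewrite 1 [show z = x - act B (jMul n x) from rfl]
        rw [inner_sub_left, h2, h3, sub_zero]
      exact ((sub_eq_zero.1 (inner_self_eq_zero.1 h4))).symm
  refine ⟨⟨W, hL⟩, fun x => proj_apply_eq ?_ fun y hy => ?_⟩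
  · rw [hW, hreal, map_add, map_add, hB.involutive, add_comm]
  · have h1 : x - (1 / 2 : ℝ) • (x + act B (jMul n x)) = (1 / 2 : ℝ) • (x - act B (jMul n x)) := by
      module
    rw [h1, inner_smul_left, horth _ y _ hy, mul_zero]
    rw [map_sub, map_sub, hB.involutive, neg_sub]

theorem proj_op_smul (W : LGr n) (q : ℍ[ℝ]) (x : HVec n) : proj W (op q • x) = op q • proj W x := by
  refine proj_apply_eq (W.1.smul_mem _ (proj_mem W x)) fun y hy => ?_
  rw [← smul_sub, inner_op_smul]
  exact inner_sub_proj W x (W.1.smul_mem _ hy)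

theorem inner_proj (W : LGr n) (x y : HVec n) : inner ℝ (proj W x) y = inner ℝ x (proj W y) :=
  Submodule.inner_starProjection_left_eq_right (W.1.restrictScalars ℝ) x y

/-- As i exchanges W and its orthogonal complement, ix = i(x - Px) + iPx is the orthogonal
decomposition of ix. -/
theorem proj_iMul (W : LGr n) (x : HVec n) : proj W (iMul x) = iMul (x - proj W x) := by
  have hL := (isLagrangian_iff W.1).1 W.2
  refine proj_apply_eq ((hL _).2 fun y hy => ?_) fun y hy => ?_
  · rw [inner_iMul, iMul_iMul, inner_neg_right, neg_neg]
    exact inner_sub_proj W x hy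
  · rw [← map_sub, sub_sub_cancel, inner_iMul, (hL _).1 (proj_mem W x) y hy, neg_zero]

theorem exists_isSkewUnitary (W : LGr n) : ∃ B : CMat n, IsSkewUnitary B ∧
    ∀ x, proj W x = (1 / 2 : ℝ) • (x + act B (jMul n x)) := by
  let R : HVec n →ₗ[ℍ[ℝ]ᵐᵒᵖ] HVec n :=
    { toFun := fun x => (2 : ℝ) • proj W x - x
      map_add' := fun x y => by simp only [map_add]; module
      map_smul' := fun c x => by
        have := proj_op_smul W c.unop x
        rw [op_unop] at this
        simp only [this, RingHom.id_apply, smul_sub, smul_comm (2 : ℝ) c] }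
  have hR : ∀ x, R x = (2 : ℝ) • proj W x - x := fun x => rfl
  have hPP : ∀ x, proj W (proj W x) = proj W x := fun x => proj_apply_eq (proj_mem W x) (by simp)
  have hRR : ∀ x, R (R x) = x := fun x => by
    simp only [hR, map_sub, map_smul, hPP]
    module
  have hRi : ∀ x, R (iMul x) = -iMul (R x) := fun x => by
    have h1 : iMul ((2 : ℝ) • proj W x) = (2 : ℝ) • iMul (proj W x) :=
      LinearMap.map_smul_of_tower _ _ _
    rw [hR, hR, proj_iMul, map_sub, map_sub, h1]
    module
  obtain ⟨A, B, hAB⟩ := exists_act_add_act_jMul R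
  -- Bj already anticommutes with i, whereas A commutes with it; the anticommutation of R therefore
  -- leaves 2iA = 0.
  have hA : A = 0 := by
    have h1 : ∀ x, act ((2 : ℝ) • (Complex.I • A)) x = act 0 x := fun x => by
      have h2 := hRi x
      have h3 : act A (iMul x) = act (Complex.I • A) x := by rw [iMul, act_mul_apply]; simp
      have h4 : iMul (act A x) = act (Complex.I • A) x := by rw [iMul, act_mul_apply]; simp
      rw [hAB, hAB, act_jMul_iMul, map_add, h3, h4, neg_add, add_left_inj] at h2
      have h5 : act (0 : CMat n) x = 0 := by ext1 a; simp [act_apply]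
      rw [act_real_smul, two_smul, h5]
      nth_rewrite 1 [h2]
      exact neg_add_cancel _
    simpa using act_injective h1
  have hRB : ∀ x, R x = act B (jMul n x) := fun x => by
    have h5 : act (0 : CMat n) x = 0 := by ext1 a; simp [act_apply]
    rw [hAB, hA, h5, zero_add]
  -- Every vector is j times another, so symmetry of Bj can be read as an identity for B alone.
  have hj : ∀ x, jMul n (-jMul n x) = x := fun x => by rw [map_neg, jMul_jMul, neg_neg]
  have hskew : Bᵀ = -B := by
    refine act_injective fun x => ?_
    rw [act_neg, ← neg_eq_iff_eq_neg, ← hj x]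
    set y := -jMul n x
    refine ext_inner_left ℝ fun z => ?_
    rw [inner_neg_right, ← inner_act_jMul, ← hRB, ← hRB, hR, hR, inner_sub_left, inner_sub_right,
      inner_smul_left, inner_smul_right, inner_proj]
    rfl
  refine ⟨B, ⟨?_, hskew⟩, fun x => ?_⟩
  · have h1 : B.map star = -star B := by
      have : B.map star = star Bᵀ := by ext a b; simp
      rw [this, hskew, star_neg]
    refine act_injective fun x => ?_
    have h2 := hRR x
    rw [hRB, hRB, act_jMul_act_jMul, h1, mul_neg, act_neg, neg_neg] at h2
    rw [h2, act_one, LinearMap.id_apply]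
  · rw [← hRB, hR]
    module

/-- The linear part of the map which sends `X = B J` to the projection `(1 + B j) / 2`. -/
noncomputable def projLinear (n : ℕ) : CMat n →ₗ[ℝ] (HVec n →L[ℝ] HVec n) where
  toFun X := LinearMap.toContinuousLinearMap
    { toFun := fun x => (1 / 2 : ℝ) • act (-(X * Matrix.J (Fin n) ℂ)) (jMul n x)
      map_add' := fun x y => by rw [map_add, map_add, smul_add]
      map_smul' := fun c x => by
        rw [LinearMap.map_smul_of_tower, LinearMap.map_smul_of_tower, smul_comm, RingHom.id_apply] }
  map_add' X Y := by
    ext1 x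
    change (1 / 2 : ℝ) • act (-((X + Y) * Matrix.J (Fin n) ℂ)) (jMul n x) =
      (1 / 2 : ℝ) • act (-(X * Matrix.J (Fin n) ℂ)) (jMul n x) +
        (1 / 2 : ℝ) • act (-(Y * Matrix.J (Fin n) ℂ)) (jMul n x)
    rw [add_mul, neg_add, act_add, smul_add]
  map_smul' c X := by
    ext1 x
    change (1 / 2 : ℝ) • act (-((c • X) * Matrix.J (Fin n) ℂ)) (jMul n x) =
      c • (1 / 2 : ℝ) • act (-(X * Matrix.J (Fin n) ℂ)) (jMul n x)
    rw [smul_mul_assoc, ← smul_neg, act_real_smul, smul_comm]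

theorem projLinear_apply (X : CMat n) (x : HVec n) :
    projLinear n X x = (1 / 2 : ℝ) • act (-(X * Matrix.J (Fin n) ℂ)) (jMul n x) := rfl

theorem neg_mul_J_injective {X Y : CMat n}
    (h : -(X * Matrix.J (Fin n) ℂ) = -(Y * Matrix.J (Fin n) ℂ)) : X = Y := by
  have h1 := congrArg (· * Matrix.J (Fin n) ℂ) h
  simpa [mul_assoc, Matrix.J_squared] using h1

theorem projLinear_injective : Function.Injective (projLinear n) := by
  intro X Y h
  refine neg_mul_J_injective (act_injective fun x => ?_)
  have h1 := DFunLike.congr_fun h (-jMul n x)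
  rw [projLinear_apply, projLinear_apply, map_neg, jMul_jMul, neg_neg] at h1
  exact smul_right_injective _ (by norm_num : (1 / 2 : ℝ) ≠ 0) h1

/-- The orthogonal projections onto Lagrangian subspaces are the affine image of `{Q Q^S}`. -/
theorem range_proj : Set.range (proj : LGr n → _) =
    (fun X => (1 / 2 : ℝ) • ContinuousLinearMap.id ℝ (HVec n) + projLinear n X) '' squares n := by
  ext P
  constructor
  · rintro ⟨W, rfl⟩
    obtain ⟨B, hB, h⟩ := exists_isSkewUnitary W
    have hX : -(B * Matrix.J (Fin n) ℂ * Matrix.J (Fin n) ℂ) = B := by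
      rw [mul_assoc, Matrix.J_squared]; simp
    refine ⟨B * Matrix.J (Fin n) ℂ, ?_, ?_⟩
    · rwa [← isSkewUnitary_iff, hX]
    · ext1 x
      rw [h, smul_add, _root_.add_apply, projLinear_apply, hX]
      rfl
  · rintro ⟨X, hX, rfl⟩
    obtain ⟨W, hW⟩ := exists_lagrangian_of_isSkewUnitary ((isSkewUnitary_iff X).2 hX)
    refine ⟨W, ?_⟩
    ext1 x
    rw [hW, smul_add, _root_.add_apply, projLinear_apply]
    rfl

theorem proj_smul (A : U2 n) (W : LGr n) (x : HVec n) :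
    proj (A • W) x = act (A : CMat n) (proj W (act (star (A : CMat n)) x)) := by
  refine proj_apply_eq ⟨_, proj_mem W _, rfl⟩ ?_
  rintro _ ⟨y, hy, rfl⟩
  rw [← star_star (A : CMat n), ← inner_act, star_star, map_sub, act_star_act]
  exact inner_sub_proj W _ hy

/-- Conjugation by A sends Bj to ABjA* = ABAᵀj, because jA* = Aᵀj; and A(-XJ)Aᵀ = -(AXA^S)J. -/
theorem proj_smul_of_eq (A : U2 n) (W : LGr n) (X : CMat n)
    (h : proj W = (1 / 2 : ℝ) • ContinuousLinearMap.id ℝ (HVec n) + projLinear n X) :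
    proj (A • W) = (1 / 2 : ℝ) • ContinuousLinearMap.id ℝ (HVec n) +
      projLinear n ((A : CMat n) * X * sAdj (A : CMat n)) := by
  have hA : (star (A : CMat n)).map star = (A : CMat n)ᵀ := by ext a b; simp
  have hX : -((A : CMat n) * X * sAdj (A : CMat n) * Matrix.J (Fin n) ℂ) =
      (A : CMat n) * (-(X * Matrix.J (Fin n) ℂ) * (A : CMat n)ᵀ) := by
    simp [sAdj, mul_assoc, Matrix.J_squared]
  ext1 x
  rw [proj_smul, h]
  simp only [_root_.add_apply, projLinear_apply, hX, map_add]
  rw [jMul_act, hA, LinearMap.map_smul_of_tower, act_mul_apply, act_mul_apply, mul_assoc]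
  congr 1
  change act (A : CMat n) ((1 / 2 : ℝ) • act (star (A : CMat n)) x) = (1 / 2 : ℝ) • x
  rw [LinearMap.map_smul_of_tower, act_act_star]

end QuaternionicVectors

end QLGr

/-! ### Testing smoothness after a smooth embedding -/

section SmoothEmbeddings

variable {𝕜 : Type*} [NontriviallyNormedField 𝕜]
  {E₁ E₂ E₃ : Type*} [NormedAddCommGroup E₁] [NormedSpace 𝕜 E₁]
  [NormedAddCommGroup E₂] [NormedSpace 𝕜 E₂] [NormedAddCommGroup E₃] [NormedSpace 𝕜 E₃]
  {H₁ H₂ H₃ : Type*} [TopologicalSpace H₁] [TopologicalSpace H₂] [TopologicalSpace H₃]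
  {I₁ : ModelWithCorners 𝕜 E₁ H₁} {I₂ : ModelWithCorners 𝕜 E₂ H₂} {I₃ : ModelWithCorners 𝕜 E₃ H₃}
  {M N P : Type*} [TopologicalSpace M] [ChartedSpace H₁ M] [TopologicalSpace N] [ChartedSpace H₂ N]
  [TopologicalSpace P] [ChartedSpace H₃ P] {n : ℕ∞ω} {f : M → N} {φ : N → P}

/-- The topological embedding supplies continuity of `f`, after which the local normal form of the
immersion supplies smoothness. -/
theorem Manifold.IsSmoothEmbedding.contMDiffOn_of_comp (hφ : IsSmoothEmbedding I₂ I₃ n φ) {V : Set M}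
    (hV : IsOpen V) (h : ContMDiffOn I₁ I₃ n (φ ∘ f) V) : ContMDiffOn I₁ I₂ n f V := by
  have hc : ContinuousOn f V := (hφ.isEmbedding.continuousOn_iff).2 h.continuousOn
  intro x hx
  have hx' := hV.mem_nhds hx
  exact ((ContMDiffAt.iff_comp_isImmersionAt (hφ.isImmersion.isImmersionAt (f x))).2
    ⟨hc.continuousAt hx', h.contMDiffAt hx'⟩).contMDiffWithinAt

theorem Manifold.IsSmoothEmbedding.contMDiff_of_comp (hφ : IsSmoothEmbedding I₂ I₃ n φ)
    (h : ContMDiff I₁ I₃ n (φ ∘ f)) : ContMDiff I₁ I₂ n f :=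
  contMDiffOn_univ.1 (hφ.contMDiffOn_of_comp isOpen_univ h.contMDiffOn)

end SmoothEmbeddings

theorem LinearMap.contDiff_of_finiteDimensional {E F : Type*} [NormedAddCommGroup E]
    [NormedSpace ℝ E] [FiniteDimensional ℝ E] [NormedAddCommGroup F] [NormedSpace ℝ F]
    (f : E →ₗ[ℝ] F) {n : ℕ∞ω} : ContDiff ℝ n f :=
  (LinearMap.toContinuousLinearMap f).contDiff

namespace QLGr

/-! ### Transfer from the operator norm to arrays of entries -/

section Entries

open scoped Matrix.Norms.L2Operator

/-- Taking the array of entries, as a linear equivalence. -/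
noncomputable def entriesEquiv (n : ℕ) : CMat n ≃ₗ[ℝ] Entries n := LinearEquiv.refl ℝ (Entries n)

/-- Taking the array of entries, as a continuous linear equivalence for the operator norm. -/
noncomputable def entriesCLE (n : ℕ) : CMat n ≃L[ℝ] Entries n :=
  (entriesEquiv n).toContinuousLinearEquiv

theorem isEmbedding_entries (n : ℕ) : Topology.IsEmbedding (entries : CMat n → Entries n) :=
  (entriesCLE n).toHomeomorph.isEmbedding

theorem _root_.IsSliced.entries {n : ℕ} {S : Set (CMat n)} {F : Submodule ℝ (CMat n)} (h : IsSliced S F) :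
    IsSliced (QLGr.entries '' S) (F.map (entriesEquiv n : CMat n →ₗ[ℝ] Entries n)) := by
  have := h.image (entriesEquiv n : CMat n →ₗ[ℝ] Entries n) (entriesEquiv n).injective 0
  simp only [zero_add] at this
  exact this

theorem isSliced_entries_unitary (n : ℕ) : IsSliced (entries '' (U2 n : Set (CMat n)))
    ((skewAdjoint.submodule ℝ (CMat n)).map (entriesEquiv n : CMat n →ₗ[ℝ] Entries n)) :=
  isSliced_unitary.entries

theorem isSliced_entries_squares (n : ℕ) : IsSliced (entries '' squares n)
    ((skewSymm n).map (entriesEquiv n : CMat n →ₗ[ℝ] Entries n)) :=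
  isSliced_squares.entries

theorem isSliced_range_proj (n : ℕ) :
    IsSliced (Set.range (proj : LGr n → _)) ((skewSymm n).map (projLinear n)) := by
  rw [range_proj]
  exact isSliced_squares.image _ projLinear_injective _

theorem contDiff_sAdj (n : ℕ) : ContDiff ℝ ∞ (sAdj : CMat n → CMat n) := by
  let L : CMat n →ₗ[ℝ] CMat n :=
    { toFun := sAdj
      map_add' := sAdj_add
      map_smul' := fun c X => sAdj_smul (c : ℂ) X }
  exact L.contDiff_of_finiteDimensional

/-- The map `Q ↦ Q Q^S` is smooth on the space of all matrices. -/
theorem exists_contDiff_square (n : ℕ) : ∃ g : Entries n → Entries n, ContDiff ℝ ∞ g ∧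
    ∀ Q : CMat n, g (entries Q) = entries (Q * sAdj Q) := by
  refine ⟨fun M => entriesCLE n ((entriesCLE n).symm M * sAdj ((entriesCLE n).symm M)), ?_,
    fun Q => rfl⟩
  exact (entriesCLE n).contDiff.comp ((entriesCLE n).symm.contDiff.mul
    ((contDiff_sAdj n).comp (entriesCLE n).symm.contDiff))

/-- The map `Q ↦ Q Q^S` has smooth local sections. -/
theorem exists_local_section {n : ℕ} {Q : CMat n} (hQ : Q ∈ U2 n) :
    ∃ (r : Entries n → Entries n) (V : Set (Entries n)), IsOpen V ∧ entries (Q * sAdj Q) ∈ V ∧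
      ContDiffOn ℝ ∞ r V ∧ ∀ Y ∈ squares n, entries Y ∈ V →
        ∃ P ∈ U2 n, entries P = r (entries Y) ∧ P * sAdj P = Y := by
  obtain ⟨r, V, hVo, h1V, hr, hrV⟩ := exists_local_sqrt n
  -- Move QQ^S to 1, take the square root there, and multiply back by Q on the left.
  let t : Entries n → CMat n := fun M => star Q * (entriesCLE n).symm M * sAdj (star Q)
  have ht : ContDiff ℝ ∞ t :=
    (contDiff_const.mul (entriesCLE n).symm.contDiff).mul contDiff_const
  have hte : ∀ Y, t (entries Y) = star Q * Y * sAdj (star Q) := fun Y => rfl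
  have hQ1 := Unitary.mul_star_self_of_mem hQ
  have hQ2 := Unitary.star_mul_self_of_mem hQ
  have hS1 : sAdj Q * sAdj (star Q) = 1 := by rw [← sAdj_mul, hQ2, sAdj_one]
  have hS2 : sAdj (star Q) * sAdj Q = 1 := by rw [← sAdj_mul, hQ1, sAdj_one]
  refine ⟨fun M => entriesCLE n (Q * r (t M)), t ⁻¹' V, hVo.preimage ht.continuous, ?_, ?_, ?_⟩
  · change t _ ∈ V
    rwa [hte, ← mul_assoc, hQ2, one_mul, hS1]
  · exact (entriesCLE n).contDiff.comp_contDiffOn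
      (contDiffOn_const.mul (hr.comp ht.contDiffOn fun _ h => h))
  · intro Y hY hYV
    have hZ : t (entries Y) ∈ squares n := by
      rw [squares_eq] at hY ⊢
      refine ⟨mul_mem (mul_mem (Unitary.star_mem hQ) hY.1)
        (sAdj_mem_unitary (Unitary.star_mem hQ)), ?_⟩
      rw [hte, sAdj_conj, ← hY.2]
    obtain ⟨h1, h2⟩ := hrV _ hYV hZ
    refine ⟨Q * r (t (entries Y)), mul_mem hQ h1, rfl, ?_⟩
    rw [sAdj_mul, mul_assoc, ← mul_assoc (r _), h2, hte]
    calc Q * (star Q * Y * sAdj (star Q) * sAdj Q)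
        = (Q * star Q) * Y * (sAdj (star Q) * sAdj Q) := by simp only [mul_assoc]
      _ = Y := by rw [hQ1, hS2, one_mul, mul_one]

theorem isEmbedding_entries_quotSquare (n : ℕ) :
    Topology.IsEmbedding fun q : U2 n ⧸ Sp n => entries (quotSquare n q) :=
  (isEmbedding_entries n).comp isEmbedding_quotSquare

end Entries

/-! ### The equivariant bijections -/

section Bijections

variable {n : ℕ}

/-- The bijection `[Q] ↦ Q Q^S`. -/
noncomputable def quotEquiv (n : ℕ) : U2 n ⧸ Sp n ≃ squares n :=
  (Equiv.ofInjective _ quotSquare_injective).trans (Equiv.setCongr range_quotSquare)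

theorem coe_quotEquiv (q : U2 n ⧸ Sp n) : (quotEquiv n q : CMat n) = quotSquare n q := rfl

/-- The matrix `X` for which the projection onto `W` is `(1 + B j) / 2` with `X = B J`. -/
theorem exists_squares_of_lagrangian (W : LGr n) : ∃ X : squares n,
    proj W = (1 / 2 : ℝ) • ContinuousLinearMap.id ℝ (HVec n) + projLinear n X := by
  obtain ⟨X, hX, h⟩ := range_proj.subset ⟨W, rfl⟩
  exact ⟨⟨X, hX⟩, h.symm⟩

/-- The matrix `X = B J` attached to a Lagrangian subspace. -/
noncomputable def lagrangianMatrix (W : LGr n) : squares n :=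
  (exists_squares_of_lagrangian W).choose

theorem proj_eq (W : LGr n) : proj W =
    (1 / 2 : ℝ) • ContinuousLinearMap.id ℝ (HVec n) + projLinear n (lagrangianMatrix W) :=
  (exists_squares_of_lagrangian W).choose_spec

theorem lagrangianMatrix_bijective : Function.Bijective (lagrangianMatrix : LGr n → squares n) := by
  refine ⟨fun V W h => proj_injective (by rw [proj_eq, proj_eq, h]), fun X => ?_⟩
  obtain ⟨W, hW⟩ := (range_proj (n := n)).superset ⟨X, X.2, rfl⟩
  refine ⟨W, Subtype.ext (projLinear_injective ?_)⟩
  rw [proj_eq] at hW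
  exact add_left_cancel hW

/-- The bijection between Lagrangian subspaces and `{Q Q^S}`. -/
noncomputable def lagrangianEquiv (n : ℕ) : LGr n ≃ squares n :=
  Equiv.ofBijective _ lagrangianMatrix_bijective

theorem proj_lagrangianEquiv_symm (X : squares n) : proj ((lagrangianEquiv n).symm X) =
    (1 / 2 : ℝ) • ContinuousLinearMap.id ℝ (HVec n) + projLinear n X := by
  rw [proj_eq]
  congr 3
  exact (lagrangianEquiv n).apply_symm_apply X

theorem lagrangianEquiv_smul (A : U2 n) (W : LGr n) :
    (lagrangianEquiv n (A • W) : CMat n) =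
      (A : CMat n) * (lagrangianEquiv n W : CMat n) * sAdj (A : CMat n) := by
  have h := proj_smul_of_eq A W _ (proj_eq W)
  rw [proj_eq] at h
  exact projLinear_injective (add_left_cancel h)

end Bijections

end QLGr

theorem mainTheorem9 (n : ℕ) (hn : 0 < n) :
    -- the three descriptions of the set of matrices
    QLGr.squares n = (QLGr.U2 n : Set (QLGr.CMat n)) ∩ (QLGr.Y2 n : Set (QLGr.CMat n)) ∧
    (QLGr.U2 n : Set (QLGr.CMat n)) ∩ (QLGr.Y2 n : Set (QLGr.CMat n)) =
      {X : QLGr.CMat n | X ∈ QLGr.U2 n ∧ X = QLGr.sAdj X} ∧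
    -- the standard smooth structures exist on `U(2n)`, `LGr`, `U(2n)/Sp(n)` and `{Q Q^S}`
    ∃ (k d : ℕ)
      (_ : ChartedSpace (EuclideanSpace ℝ (Fin k)) (QLGr.U2 n))
      (_ : ChartedSpace (EuclideanSpace ℝ (Fin d)) (QLGr.LGr n))
      (_ : ChartedSpace (EuclideanSpace ℝ (Fin d)) (QLGr.U2 n ⧸ QLGr.Sp n))
      (_ : ChartedSpace (EuclideanSpace ℝ (Fin d)) (QLGr.squares n)),
      IsManifold (𝓡 k) ∞ (QLGr.U2 n) ∧
      IsManifold (𝓡 d) ∞ (QLGr.LGr n) ∧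
      IsManifold (𝓡 d) ∞ (QLGr.U2 n ⧸ QLGr.Sp n) ∧
      IsManifold (𝓡 d) ∞ (QLGr.squares n) ∧
      -- `U(2n)` and `{Q Q^S}` are embedded submanifolds of the space of complex matrices
      IsSmoothEmbedding (𝓡 k) 𝓘(ℝ, QLGr.Entries n) ∞ (fun Q : QLGr.U2 n => QLGr.entries (Q : QLGr.CMat n)) ∧
      IsSmoothEmbedding (𝓡 d) 𝓘(ℝ, QLGr.Entries n) ∞
        (fun X : QLGr.squares n => QLGr.entries (X : QLGr.CMat n)) ∧
      -- `LGr` is an embedded submanifold of the Grassmannian, viewed as orthogonal projections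
      IsSmoothEmbedding (𝓡 d) 𝓘(ℝ, QLGr.HVec n →L[ℝ] QLGr.HVec n) ∞
        (QLGr.proj : QLGr.LGr n → QLGr.HVec n →L[ℝ] QLGr.HVec n) ∧
      -- `U(2n)/Sp(n)` carries the smooth structure of a homogeneous space
      QLGr.IsSmoothQuotient (k := k) (d := d) (QLGr.Sp n) ∧
      -- the two `U(2n)`-equivariant diffeomorphisms
      (∃ Φ : QLGr.LGr n ≃ₘ^∞⟮𝓡 d, 𝓡 d⟯ (QLGr.U2 n ⧸ QLGr.Sp n),
        ∀ (A : QLGr.U2 n) (W : QLGr.LGr n), Φ (A • W) = A • Φ W) ∧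
      (∃ Ψ : (QLGr.U2 n ⧸ QLGr.Sp n) ≃ₘ^∞⟮𝓡 d, 𝓡 d⟯ QLGr.squares n,
        ∀ (A : QLGr.U2 n) (q : QLGr.U2 n ⧸ QLGr.Sp n),
          ((Ψ (A • q) : QLGr.squares n) : QLGr.CMat n) =
            (A : QLGr.CMat n) * (Ψ q : QLGr.CMat n) * QLGr.sAdj (A : QLGr.CMat n)) := by

  have hk : Module.finrank ℝ ((skewAdjoint.submodule ℝ (QLGr.CMat n)).map
      (QLGr.entriesEquiv n : QLGr.CMat n →ₗ[ℝ] QLGr.Entries n)) =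
      Module.finrank ℝ (skewAdjoint.submodule ℝ (QLGr.CMat n)) :=
    LinearEquiv.finrank_map_eq _ _
  have hd : Module.finrank ℝ ((QLGr.skewSymm n).map
      (QLGr.entriesEquiv n : QLGr.CMat n →ₗ[ℝ] QLGr.Entries n)) =
      Module.finrank ℝ (QLGr.skewSymm n) :=
    LinearEquiv.finrank_map_eq _ _
  have hd' : Module.finrank ℝ ((QLGr.skewSymm n).map (QLGr.projLinear n)) =
      Module.finrank ℝ (QLGr.skewSymm n) :=
    ((QLGr.skewSymm n).equivMapOfInjective _ QLGr.projLinear_injective).symm.finrank_eq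
  refine ⟨QLGr.squares_eq, rfl, Module.finrank ℝ (skewAdjoint.submodule ℝ (QLGr.CMat n)),
    Module.finrank ℝ (QLGr.skewSymm n), ?_⟩
  obtain ⟨csU, mU, eU⟩ := (QLGr.isSliced_entries_unitary n).exists_chartedSpace hk
    (f := fun Q : QLGr.U2 n => QLGr.entries (Q : QLGr.CMat n))
    ((QLGr.isEmbedding_entries n).comp Topology.IsEmbedding.subtypeVal) (by
      ext; simp)
  obtain ⟨csS, mS, eS⟩ := (QLGr.isSliced_entries_squares n).exists_chartedSpace hd
    (f := fun X : QLGr.squares n => QLGr.entries (X : QLGr.CMat n))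
    ((QLGr.isEmbedding_entries n).comp Topology.IsEmbedding.subtypeVal) (by
      ext; simp)
  -- The quotient is given the smooth structure induced by [Q] ↦ QQ^S; its compatibility with the
  -- projection from U(2n) is verified separately below.
  obtain ⟨csG, mG, eG⟩ := (QLGr.isSliced_entries_squares n).exists_chartedSpace hd
    (QLGr.isEmbedding_entries_quotSquare n) (by
      rw [← QLGr.range_quotSquare, ← Set.range_comp]; rfl)
  obtain ⟨csL, mL, eL⟩ := (QLGr.isSliced_range_proj n).exists_chartedSpace hd'
    (f := (QLGr.proj : QLGr.LGr n → _)) ⟨⟨rfl⟩, QLGr.proj_injective⟩ rfl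
  refine ⟨csU, csL, csG, csS, mU, mL, mG, mS, eU, eS, eL, ⟨?_, ?_⟩, ?_, ?_⟩
  · obtain ⟨g, hg, hgQ⟩ := QLGr.exists_contDiff_square n
    refine eG.contMDiff_of_comp ((hg.contMDiff.comp eU.contMDiff).congr fun Q => ?_)
    exact (hgQ Q).symm
  · intro q
    obtain ⟨Q, rfl⟩ := QuotientGroup.mk_surjective q
    obtain ⟨r, V, hVo, hQV, hr, hrV⟩ := QLGr.exists_local_section Q.2
    have hsec : ∀ p : QLGr.U2 n ⧸ QLGr.Sp n, QLGr.entries (QLGr.quotSquare n p) ∈ V →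
        ∃ P : QLGr.U2 n, QLGr.entries (P : QLGr.CMat n) = r (QLGr.entries (QLGr.quotSquare n p)) ∧
          (QuotientGroup.mk P : QLGr.U2 n ⧸ QLGr.Sp n) = p := fun p hp => by
      obtain ⟨P, hP, h1, h2⟩ := hrV _ (QLGr.range_quotSquare.subset ⟨p, rfl⟩) hp
      exact ⟨⟨P, hP⟩, h1, QLGr.quotSquare_injective h2⟩
    choose! s hs1 hs2 using hsec
    refine ⟨_, hVo.preimage eG.isEmbedding.continuous, hQV, s, ?_, hs2⟩
    refine eU.contMDiffOn_of_comp (hVo.preimage eG.isEmbedding.continuous) ?_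
    exact (hr.contMDiffOn.comp eG.contMDiff.contMDiffOn fun _ h => h).congr hs1
  -- A linear left inverse recovers X from the projection by T ↦ l(T - 1/2), smooth on the whole
  -- ambient space.
  · obtain ⟨l, hl⟩ := LinearMap.exists_leftInverse_of_injective (QLGr.projLinear n)
      (LinearMap.ker_eq_bot.2 QLGr.projLinear_injective)
    have hl' : ∀ X, l (QLGr.projLinear n X) = X := LinearMap.congr_fun hl
    let c : QLGr.HVec n →L[ℝ] QLGr.HVec n := (1 / 2 : ℝ) • ContinuousLinearMap.id ℝ (QLGr.HVec n)
    have h1 : ContDiff ℝ ∞ fun T : QLGr.HVec n →L[ℝ] QLGr.HVec n =>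
        (QLGr.entriesEquiv n : QLGr.CMat n →ₗ[ℝ] QLGr.Entries n) (l (T - c)) :=
      (LinearMap.contDiff_of_finiteDimensional (E := QLGr.HVec n →L[ℝ] QLGr.HVec n)
        (F := QLGr.Entries n) (QLGr.entriesEquiv n ∘ₗ l)).comp (contDiff_id.sub contDiff_const)
    have h2 : ContDiff ℝ ∞ fun M : QLGr.Entries n =>
        c + QLGr.projLinear n ((QLGr.entriesEquiv n).symm M) :=
      contDiff_const.add (LinearMap.contDiff_of_finiteDimensional (E := QLGr.Entries n)
        (F := QLGr.HVec n →L[ℝ] QLGr.HVec n) (QLGr.projLinear n ∘ₗ (QLGr.entriesEquiv n).symm))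
    have hq : ∀ X, QLGr.quotSquare n ((QLGr.quotEquiv n).symm X) = X := fun X => by
      rw [← QLGr.coe_quotEquiv, Equiv.apply_symm_apply]
    refine ⟨⟨(QLGr.lagrangianEquiv n).trans (QLGr.quotEquiv n).symm, ?_, ?_⟩, fun A W => ?_⟩
    · refine eG.contMDiff_of_comp ((h1.contMDiff.comp eL.contMDiff).congr fun W => ?_)
      change QLGr.entries (QLGr.quotSquare n ((QLGr.quotEquiv n).symm (QLGr.lagrangianEquiv n W))) =
        QLGr.entries (l (QLGr.proj W - c))
      rw [hq, QLGr.proj_eq, add_sub_cancel_left, hl']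
      rfl
    · refine eL.contMDiff_of_comp ((h2.contMDiff.comp eG.contMDiff).congr fun q => ?_)
      exact QLGr.proj_lagrangianEquiv_symm (QLGr.quotEquiv n q)
    · refine QLGr.quotSquare_injective ?_
      change QLGr.quotSquare n ((QLGr.quotEquiv n).symm (QLGr.lagrangianEquiv n (A • W))) =
        QLGr.quotSquare n (A • (QLGr.quotEquiv n).symm (QLGr.lagrangianEquiv n W))
      rw [hq, QLGr.quotSquare_smul, hq, QLGr.lagrangianEquiv_smul]
  · refine ⟨⟨QLGr.quotEquiv n, ?_, ?_⟩, QLGr.quotSquare_smul⟩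
    -- Composed with the inclusion of {QQ^S}, this bijection is by definition the embedding that
    -- defined the charts of the quotient.
    · exact eS.contMDiff_of_comp eG.contMDiff
    · refine eG.contMDiff_of_comp (eS.contMDiff.congr fun X => ?_)
      change QLGr.entries (QLGr.quotSquare n ((QLGr.quotEquiv n).symm X)) = _
      rw [← QLGr.coe_quotEquiv, Equiv.apply_symm_apply]
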